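/- **Setting.** Let $\Omega\subset\mathbb{R}^d$ be a bounded open set and let $V$ be a closed subspace of $H^1(\Omega)$ with $H^1_0(\Omega)\subset V$. Let $\alpha,\sigma,\tilde\alpha,\tilde\sigma:\Omega\to\mathbb{R}$ be measurable with $0<\alpha_{\min}\le\alpha\le\alpha_{\max}<\infty$, $0<\tilde\alpha_{\min}\le\tilde\alpha\le\tilde\alpha_{\max}<\infty$ almost everywhere and $\sigma,\tilde\sigma\ge 0$ essentially bounded, let $f,\tilde f\in L^2(\Omega)$, and put $$a(w,v)=\int_\Omega \alpha\,\nabla w\cdot\nabla v+\sigma w v\,dx,\quad \ell(v)=\int_\Omega f v\,dx,\quad \tilde a(w,v)=\int_\Omega \tilde\alpha\,\nabla w\cdot\nabla v+\tilde\sigma w v\,dx,\quad \tilde\ell(v)=\int_\Omega \tilde f v\,dx .$$ For $i=1,\dots,m$ let $B_i\subset\Omega$ be open and nonempty, let $K_i\supset B_i$ be convex with interior contained in $\Omega$, and assume $\Omega\subset\bigcup_{i=1}^m\overline{K_i}$. Let $$M=\max_{x\in\Omega}\#\{i: x\in K_i\},\qquad R=\max_i \operatorname{diam}(K_i),\qquad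 \eta=\begin{cases}1 & \text{if } B_i=K_i \text{ for all } i,\\ 3\max_i |K_i|/|B_i| & \text{otherwise}\end{cases}$$ (if $m=0$, which forces $\Omega=\emptyset$, the maxima are read as $0$). With the averages $\langle v\rangle_i=|B_i|^{-1}\int_{B_i}v\,dx$, given numbers $b_1,\dots,b_m\in\mathbb{R}$ and $\delta>0$, put $$b(w,v)=\sum_{i=1}^m|B_i|\,\langle w\rangle_i\,\langle v\rangle_i,\qquad \widetilde{b(u,v)}=\sum_{i=1}^m b_i|B_i|\,\langle v\rangle_i,$$ $$\tilde c(w,v)=\tilde a(w,v)+\delta^{-1}b(w,v),\qquad \tilde r(v)=\tilde\ell(v)+\delta^{-1}\widetilde{b(u,v)},\qquad \|v\|_{\tilde c}=\tilde c(v,v)^{1/2}.$$ A functional $F$ on $V$ is said to belong to $L^2(\Omega)$ if there is $g\in L^2(\Omega)$ with $F(v)=\int_\Omega g v\,dx$ for all $v\in V$; this $g$ is unique, and $\|F\|_{L^2(\Omega)}$ denotes $\|g\|_{L^2(\Omega)}$. **Theorem.** Let $u\in V$ satisfy $a(u,v)=\ell(v)$ for all $v\in V$ and let $\tilde u\in V$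 satisfy $\tilde c(\tilde u,v)=\tilde r(v)$ for all $v\in V$. Assume that $\tilde\ell-\tilde a(u,\cdot)\in L^2(\Omega)$, and set $$\mathbb{E}_{\mathrm{pde}}=\|\tilde\ell-\tilde a(u,\cdot)\|_{L^2(\Omega)},\qquad \mathbb{E}_{\mathrm{data}}=\|\widetilde{b(u,\cdot)}-b(u,\cdot)\|_{L^2(\Omega)},\qquad \Gamma=\eta\max\Bigl\{\frac{R^2M}{\pi^2\tilde\alpha_{\min}},\,\delta\Bigr\}.$$ Then $$\|\tilde u-u\|_{L^2(\Omega)}\le\sqrt{\Gamma}\,\|\tilde u-u\|_{\tilde c}\le\Gamma\bigl(\mathbb{E}_{\mathrm{pde}}+\delta^{-1}\mathbb{E}_{\mathrm{data}}\bigr).$$ Moreover, for every $\theta\in(0,1]$ such that $\delta\in\Bigl[\theta\frac{R^2M}{\pi^2\tilde\alpha_{\min}},\ \theta^{-1}\frac{R^2M}{\pi^2\tilde\alpha_{\min}}\Bigr]$, $$\|\tilde u-u\|_{L^2(\Omega)}\le\sqrt{\Gamma}\,\|\tilde u-u\|_{\tilde c}\le\eta\,\theta^{-1}\Bigl(\frac{R^2M}{\pi^2\tilde\alpha_{\min}}\,\mathbb{E}_{\mathrm{pde}}+\mathbb{E}_{\mathrm{data}}\Bigr).$$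 -/

import Mathlib

open MeasureTheory Set
open scoped ContDiff

noncomputable section

namespace PDEReg

/-- The space `ℝᵈ` with its Euclidean norm. -/
abbrev Space (d : ℕ) : Type := EuclideanSpace ℝ (Fin d)

/-- The Hilbert space `L²(Ω)`. -/
abbrev L2 {d : ℕ} (Ω : Set (Space d)) : Type :=
  Lp ℝ 2 (volume.restrict Ω)

/-- The Hilbert space `L²(Ω; ℝᵈ)`. -/
abbrev L2Vec {d : ℕ} (Ω : Set (Space d)) : Type :=
  Lp (Space d) 2 (volume.restrict Ω)

/-- `φ ∈ C_c^∞(Ω)`. -/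
structure IsTest {d : ℕ} (Ω : Set (Space d)) (φ : Space d → ℝ) : Prop where
  smooth : ContDiff ℝ ∞ φ
  compact : HasCompactSupport φ
  supp : tsupport φ ⊆ Ω

/-- `G` is the weak gradient of `w` on `Ω`:
`∫_Ω w ∂ₑφ = - ∫_Ω (G · e) φ` for all directions `e` and all `φ ∈ C_c^∞(Ω)`. -/
def IsWeakGradient {d : ℕ} (Ω : Set (Space d)) (w : L2 Ω) (G : L2Vec Ω) : Prop :=
  ∀ φ : Space d → ℝ, IsTest Ω φ → ∀ e : Space d,
    ∫ x in Ω, w x * fderiv ℝ φ x e = - ∫ x in Ω, inner ℝ (G x) e * φ x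

theorem IsTest.memLp {d : ℕ} {Ω : Set (Space d)} {φ : Space d → ℝ} (h : IsTest Ω φ) :
    MemLp φ 2 (volume.restrict Ω) :=
  (h.smooth.continuous.memLp_of_hasCompactSupport h.compact).restrict Ω

theorem IsTest.memLp_fderiv {d : ℕ} {Ω : Set (Space d)} {φ : Space d → ℝ} (h : IsTest Ω φ)
    (e : Space d) : MemLp (fun x => fderiv ℝ φ x e) 2 (volume.restrict Ω) := by
  have hc : Continuous (fun x => fderiv ℝ φ x e) :=
    (h.smooth.continuous_fderiv (by simp)).clm_apply continuous_const
  exact (hc.memLp_of_hasCompactSupport (h.compact.fderiv_apply ℝ e)).restrict Ω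

/-- The Sobolev space `H¹(Ω)`, realised as the space of pairs `(w, ∇w)` of an `L²(Ω)` function and
its weak gradient, which is again in `L²`. It inherits the usual norm
`‖w‖²_{H¹} = ‖w‖²_{L²} + ‖∇w‖²_{L²}` from the Hilbert sum `L²(Ω) ⊕ L²(Ω; ℝᵈ)`. -/
def H1 {d : ℕ} (Ω : Set (Space d)) : Submodule ℝ (WithLp 2 (L2 Ω × L2Vec Ω)) where
  carrier := {p | IsWeakGradient Ω p.fst p.snd}
  zero_mem' := by
    intro φ hφ e
    change ∫ x in Ω, (0 : L2 Ω) x * fderiv ℝ φ x e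
      = - ∫ x in Ω, inner ℝ ((0 : L2Vec Ω) x) e * φ x
    rw [integral_eq_zero_of_ae, integral_eq_zero_of_ae, neg_zero]
    · filter_upwards [Lp.coeFn_zero (Space d) 2 (volume.restrict Ω)] with x hx
      rw [hx]
      simp
    · filter_upwards [Lp.coeFn_zero ℝ 2 (volume.restrict Ω)] with x hx
      rw [hx]
      simp
  add_mem' := by
    intro p q hp hq φ hφ e
    have h1 : ∫ x in Ω, (p + q).fst x * fderiv ℝ φ x e
        = ∫ x in Ω, (p.fst x * fderiv ℝ φ x e + q.fst x * fderiv ℝ φ x e) := by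
      refine integral_congr_ae ?_
      filter_upwards [Lp.coeFn_add p.fst q.fst] with x hx
      change (p.fst + q.fst) x * _ = _
      rw [hx, Pi.add_apply, add_mul]
    have h2 : ∫ x in Ω, inner ℝ ((p + q).snd x) e * φ x
        = ∫ x in Ω, (inner ℝ (p.snd x) e * φ x + inner ℝ (q.snd x) e * φ x) := by
      refine integral_congr_ae ?_
      filter_upwards [Lp.coeFn_add p.snd q.snd] with x hx
      change inner ℝ ((p.snd + q.snd) x) e * _ = _
      rw [hx, Pi.add_apply, inner_add_left, add_mul]
    have i1 : ∀ w : L2 Ω, Integrable (fun x => w x * fderiv ℝ φ x e) (volume.restrict Ω) :=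
      fun w => (Lp.memLp w).integrable_mul (hφ.memLp_fderiv e)
    have i2 : ∀ G : L2Vec Ω,
        Integrable (fun x => inner ℝ (G x) e * φ x) (volume.restrict Ω) :=
      fun G => ((Lp.memLp G).inner_const e).integrable_mul hφ.memLp
    rw [h1, h2, integral_add (i1 _) (i1 _), integral_add (i2 _) (i2 _), hp φ hφ e, hq φ hφ e]
    ring
  smul_mem' := by
    intro c p hp φ hφ e
    have h1 : ∫ x in Ω, (c • p).fst x * fderiv ℝ φ x e
        = ∫ x in Ω, c * (p.fst x * fderiv ℝ φ x e) := by
      refine integral_congr_ae ?_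
      filter_upwards [Lp.coeFn_smul c p.fst] with x hx
      simp [hx, mul_assoc]
    have h2 : ∫ x in Ω, inner ℝ ((c • p).snd x) e * φ x
        = ∫ x in Ω, c * (inner ℝ (p.snd x) e * φ x) := by
      refine integral_congr_ae ?_
      filter_upwards [Lp.coeFn_smul c p.snd] with x hx
      simp [hx, real_inner_smul_left, mul_assoc]
    rw [h1, h2, integral_const_mul, integral_const_mul, hp φ hφ e]
    ring

/-- The element `w` of `H¹(Ω)` as an element of `L²(Ω)`. -/
def fn {d : ℕ} {Ω : Set (Space d)} (w : H1 Ω) : L2 Ω := w.1.fst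

/-- The weak gradient `∇w` of `w ∈ H¹(Ω)`. -/
def grad {d : ℕ} {Ω : Set (Space d)} (w : H1 Ω) : L2Vec Ω := w.1.snd

/-- The image of `C_c^∞(Ω)` in `H¹(Ω)`. -/
def testH1 {d : ℕ} (Ω : Set (Space d)) : Set (H1 Ω) :=
  {w | ∃ φ : Space d → ℝ, IsTest Ω φ ∧ fn w =ᵐ[volume.restrict Ω] φ}

/-- `H¹₀(Ω)`, the closure of `C_c^∞(Ω)` in `H¹(Ω)`. -/
def H10 {d : ℕ} (Ω : Set (Space d)) : Set (H1 Ω) := closure (testH1 Ω)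

/-- The data `α, σ, f` of an elliptic problem `-div(α ∇u) + σ u = f` on `Ω`, with
`0 < αmin ≤ α ≤ αmax` and `0 ≤ σ ≤ σmax` almost everywhere in `Ω` and `f ∈ L²(Ω)`. -/
structure EllipticData {d : ℕ} (Ω : Set (Space d)) where
  α : Space d → ℝ
  σ : Space d → ℝ
  f : L2 Ω
  αmin : ℝ
  αmax : ℝ
  σmax : ℝ
  α_meas : AEStronglyMeasurable α (volume.restrict Ω)
  σ_meas : AEStronglyMeasurable σ (volume.restrict Ω)
  αmin_pos : 0 < αmin
  α_bounds : ∀ᵐ x ∂(volume.restrict Ω), αmin ≤ α x ∧ α x ≤ αmax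
  σ_bounds : ∀ᵐ x ∂(volume.restrict Ω), 0 ≤ σ x ∧ σ x ≤ σmax

/-- The bilinear form `a(w,v) = ∫_Ω α ∇w · ∇v + σ w v dx`. -/
def EllipticData.a {d : ℕ} {Ω : Set (Space d)} (P : EllipticData Ω) (w v : H1 Ω) : ℝ :=
  ∫ x in Ω, (P.α x * inner ℝ (grad w x) (grad v x) + P.σ x * fn w x * fn v x)

/-- The functional `ℓ(v) = ∫_Ω f v dx`. -/
def EllipticData.l {d : ℕ} {Ω : Set (Space d)} (P : EllipticData Ω) (v : H1 Ω) : ℝ :=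
  ∫ x in Ω, P.f x * fn v x

/-- Local data on `Ω`: open nonempty sets `B i ⊆ Ω` carrying the (possibly inexact) local average
values `val i`, and convex sets `K i ⊇ B i` with interior in `Ω` whose closures cover `Ω`. -/
structure LocalData {d : ℕ} (Ω : Set (Space d)) (m : ℕ) where
  B : Fin m → Set (Space d)
  K : Fin m → Set (Space d)
  val : Fin m → ℝ
  B_open : ∀ i, IsOpen (B i)
  B_nonempty : ∀ i, (B i).Nonempty
  B_subset : ∀ i, B i ⊆ Ω
  B_subset_K : ∀ i, B i ⊆ K i
  K_convex : ∀ i, Convex ℝ (K i)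
  K_interior : ∀ i, interior (K i) ⊆ Ω
  K_cover : Ω ⊆ ⋃ i, closure (K i)

namespace LocalData

variable {d : ℕ} {Ω : Set (Space d)} {m : ℕ}

/-- The maximal overlap `M = max_{x ∈ Ω} #{i | x ∈ K i}`. -/
def M (D : LocalData Ω m) : ℕ := ⨆ x : Ω, {i | (x : Space d) ∈ D.K i}.ncard

/-- The maximal diameter `R = max_i diam (K i)`. -/
def R (D : LocalData Ω m) : ℝ := ⨆ i, Metric.diam (D.K i)

open Classical in
/-- The mismatch constant: `η = 1` if `B i = K i` for all `i`, and
`η = 3 max_i |K i| / |B i|` otherwise. -/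
def η (D : LocalData Ω m) : ℝ :=
  if ∀ i, D.B i = D.K i then 1 else 3 * ⨆ i, volume.real (D.K i) / volume.real (D.B i)

/-- The average of `w` over `B i`. -/
def avg (D : LocalData Ω m) (w : H1 Ω) (i : Fin m) : ℝ := ⨍ x in D.B i, fn w x

/-- The bilinear form `b(w,v) = ∑ᵢ |Bᵢ| (⨍_{Bᵢ} w) (⨍_{Bᵢ} v)`. -/
def b (D : LocalData Ω m) (w v : H1 Ω) : ℝ :=
  ∑ i, volume.real (D.B i) * D.avg w i * D.avg v i

/-- The inexact data term `v ↦ ∑ᵢ bᵢ |Bᵢ| ⨍_{Bᵢ} v`, which approximates `b(u,·)`. -/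
def bInexact (D : LocalData Ω m) (v : H1 Ω) : ℝ :=
  ∑ i, D.val i * volume.real (D.B i) * D.avg v i

/-- The augmented bilinear form `c(w,v) = a(w,v) + δ⁻¹ b(w,v)`. -/
def c (D : LocalData Ω m) (P : EllipticData Ω) (δ : ℝ) (w v : H1 Ω) : ℝ :=
  P.a w v + δ⁻¹ * D.b w v

/-- The augmented right hand side, `ℓ(v)` plus `δ⁻¹` times the inexact data term. -/
def r (D : LocalData Ω m) (P : EllipticData Ω) (δ : ℝ) (v : H1 Ω) : ℝ :=
  P.l v + δ⁻¹ * D.bInexact v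

/-- The energy (semi-)norm `‖v‖_c = c(v,v)^{1/2}`. -/
def cNorm (D : LocalData Ω m) (P : EllipticData Ω) (δ : ℝ) (v : H1 Ω) : ℝ :=
  √(D.c P δ v v)

/-- The Poincaré-type quantity `R² M / (π² αmin)`. -/
def κ (D : LocalData Ω m) (P : EllipticData Ω) : ℝ :=
  D.R ^ 2 * (D.M : ℝ) / (Real.pi ^ 2 * P.αmin)

/-- The constant `Γ = η max {R² M / (π² αmin), δ}`. -/
def Γ (D : LocalData Ω m) (P : EllipticData Ω) (δ : ℝ) : ℝ :=
  D.η * max (D.κ P) δ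

end LocalData

/-- The functions `g ∈ L²(Ω)` that represent the functional `F` on `V`:
`F(v) = ∫_Ω g v dx` for all `v ∈ V`. There is at most one if `H¹₀(Ω) ⊆ V`. -/
def representers {d : ℕ} {Ω : Set (Space d)} (V : Submodule ℝ (H1 Ω)) (F : H1 Ω → ℝ) :
    Set (L2 Ω) :=
  {g | ∀ v ∈ V, F v = ∫ x in Ω, g x * fn v x}

/-- `F ∈ L²(Ω)` for a functional `F` on `V`. -/
def IsL2Functional {d : ℕ} {Ω : Set (Space d)} (V : Submodule ℝ (H1 Ω)) (F : H1 Ω → ℝ) : Prop :=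
  (representers V F).Nonempty

/-- `‖F‖_{L²(Ω)}` for a functional `F ∈ L²(Ω)` on `V`: the `L²` norm of the function that
represents it. -/
def l2FunctionalNorm {d : ℕ} {Ω : Set (Space d)} (V : Submodule ℝ (H1 Ω)) (F : H1 Ω → ℝ) : ℝ :=
  sInf ((fun g : L2 Ω => ‖g‖) '' representers V F)

/-- The PDE error term, the `L²(Ω)` norm of the residual `ℓ - a(u,·)`. -/
def Epde {d : ℕ} {Ω : Set (Space d)} (V : Submodule ℝ (H1 Ω)) (P : EllipticData Ω)
    (u : H1 Ω) : ℝ :=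
  l2FunctionalNorm V (fun v => P.l v - P.a u v)

/-- The data error term, the `L²(Ω)` norm of the inexact data term minus `b(u,·)`. -/
def Edata {d m : ℕ} {Ω : Set (Space d)} (V : Submodule ℝ (H1 Ω)) (D : LocalData Ω m)
    (u : H1 Ω) : ℝ :=
  l2FunctionalNorm V (fun v => D.bInexact v - D.b u v)

end PDEReg

end

/-!
The heart of the matter is the stability estimate `‖v‖² ≤ Γ c(v,v)` for `v ∈ H¹(Ω)`
(`LocalData.norm_sq_le_Γ_mul_c`). Testing the equation of `u'` with the error `e = u' - u` gives
`c(e,e) = (ℓ - a(u,·))(e) + δ⁻¹ (b̃ - b(u,·))(e)`, where `b̃` is the inexact data term. Both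
functionals are represented by `L²` functions, so `‖e‖_c² ≤ (E_pde + δ⁻¹ E_data) ‖e‖`, and the
stability estimate absorbs `‖e‖` into `√Γ ‖e‖_c`. The second form of the estimate only uses
`max (κ, δ) ≤ θ⁻¹ κ` and `max (κ, δ) ≤ θ⁻¹ δ`.

The stability estimate is the sum over `i` of Poincaré inequalities on the convex sets `K i` with the
Payne–Weinberger constant `diam (K i) / π`; a mean over `B i` in place of `K i` costs the factor
`3 |K i| / |B i|`. The Payne–Weinberger inequality is proved by reduction to dimension one.

* The class of weights consists of the bounded log-concave functions `p` with support of diameter at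
  most `D` (`IsLogConcaveWeight`); it contains the indicators of convex sets, it is stable under
  restriction to half-spaces, and by the Prékopa–Leindler inequality under marginals
  (`IsLogConcaveWeight.marginal`).
* On the line, the inequality is dual to a weighted Wirtinger inequality for functions vanishing at
  the ends of an interval, which has an elementary proof for weights `exp φ` with `φ'' ≤ 0`
  (`mul_integral_sq_mul_exp_neg_le`).
* In dimension `n + 2`, let `∫ f p = 0`. Through each point of a fine net of the plane of the first
  two coordinates passes a line that cuts `p` into two weights which still satisfy `∫ f p = 0`. After
  cutting at all points of the net, the projection of the support to the plane is a convex set whose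
  interior contains no point of the net, and such a set is thin in some direction
  (`exists_net_forall_thin`). On a thin piece, `f` is nearly constant in the thin direction, and the
  inequality in dimension `n + 1` applies to the marginal of `p`
  (`SharpPoincare.integral_sq_mul_le_of_thin`).

This proves the inequality for `C¹` functions (`sharpPoincare_space`). For a weakly differentiable
function it is applied to mollifications, on the part of `K` where these see only values in `K`;
Jensen's inequality controls their gradients and Fatou's lemma yields the limit
(`IsWeakGradient.variance_le`).
-/

namespace PDEReg

/-! ### The weighted Wirtinger inequality on an interval -/

/-- Wirtinger's inequality `k² ∫ F² / p ≤ ∫ F'² / p` for the log-concave weight `p = exp φ` and `F`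
vanishing at both ends. With `c = -k tan (k (x - mid))`, which solves `c' = -k² - c²`, the integrand
`(F'² - k² F²) / p` exceeds the derivative of `F² (c + φ'/2) / p` by
`((F' - F (c + φ'/2))² + F² (φ'² / 4 - φ'' / 2)) / p ≥ 0`. -/
theorem mul_integral_sq_mul_exp_neg_le {a b k : ℝ} (hab : a < b) (hk : 0 ≤ k)
    (hkab : k * (b - a) < Real.pi) {φ φ' φ'' F F' : ℝ → ℝ}
    (hφ : ∀ x ∈ Icc a b, HasDerivAt φ (φ' x) x) (hφ' : ∀ x ∈ Icc a b, HasDerivAt φ' (φ'' x) x)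
    (hφ'' : ContinuousOn φ'' (Icc a b)) (hneg : ∀ x ∈ Icc a b, φ'' x ≤ 0)
    (hFc : ContinuousOn F (Icc a b)) (hF : ∀ x ∈ Ioo a b, HasDerivAt F (F' x) x)
    (hF' : ContinuousOn F' (Icc a b)) (hFa : F a = 0) (hFb : F b = 0) :
    k ^ 2 * ∫ x in a..b, F x ^ 2 * Real.exp (-φ x) ≤ ∫ x in a..b, F' x ^ 2 * Real.exp (-φ x) := by
  have hφc : ContinuousOn φ (Icc a b) := fun x hx => (hφ x hx).continuousAt.continuousWithinAt
  have hφ'c : ContinuousOn φ' (Icc a b) := fun x hx => (hφ' x hx).continuousAt.continuousWithinAt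
  set mid := (a + b) / 2 with hmid
  set c : ℝ → ℝ := fun x => -k * Real.tan (k * (x - mid)) with hc
  have hcos : ∀ x ∈ Icc a b, Real.cos (k * (x - mid)) ≠ 0 := by
    intro x hx
    apply ne_of_gt
    apply Real.cos_pos_of_mem_Ioo
    constructor <;> nlinarith [hx.1, hx.2]
  have hcd : ∀ x ∈ Icc a b, HasDerivAt c (-k ^ 2 - c x ^ 2) x := by
    intro x hx
    have h1 : HasDerivAt (fun x => k * (x - mid)) k x := by
      simpa using ((hasDerivAt_id x).sub_const mid).const_mul k
    have h2 := ((Real.hasDerivAt_tan (hcos x hx)).comp x h1).const_mul (-k)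
    refine h2.congr_deriv ?_
    simp only [hc, Real.tan_eq_sin_div_cos]
    have := Real.sin_sq_add_cos_sq (k * (x - mid))
    have h0 := hcos x hx
    field_simp
    nlinarith
  have hcc : ContinuousOn c (Icc a b) := fun x hx => (hcd x hx).continuousAt.continuousWithinAt
  set W : ℝ → ℝ := fun x => F x ^ 2 * (c x + φ' x / 2) * Real.exp (-φ x) with hW
  set W' : ℝ → ℝ := fun x => (2 * F x * F' x * (c x + φ' x / 2)
    + F x ^ 2 * (-k ^ 2 - c x ^ 2 + φ'' x / 2) - F x ^ 2 * (c x + φ' x / 2) * φ' x)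
      * Real.exp (-φ x) with hW'
  have hWd : ∀ x ∈ Ioo a b, HasDerivAt W (W' x) x := by
    intro x hx
    have hx' := Ioo_subset_Icc_self hx
    have h := (((hF x hx).pow 2).mul ((hcd x hx').add ((hφ' x hx').div_const 2))).mul
      (hφ x hx').neg.exp
    refine h.congr_deriv ?_
    simp only [hW']
    simp
    ring
  have hWc : ContinuousOn W (Icc a b) := by fun_prop
  have hWc' : ContinuousOn W' (Icc a b) := by fun_prop
  have hint : ∀ g : ℝ → ℝ, ContinuousOn g (Icc a b) → IntervalIntegrable g volume a b := by
    intro g hg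
    exact hg.intervalIntegrable_of_Icc hab.le
  have h0 : ∫ x in a..b, W' x = 0 := by
    rw [intervalIntegral.integral_eq_sub_of_hasDerivAt_of_le hab.le hWc hWd (hint _ hWc')]
    simp [hW, hFa, hFb]
  rw [← intervalIntegral.integral_const_mul]
  have h1 : ∫ x in a..b, (k ^ 2 * (F x ^ 2 * Real.exp (-φ x)) + W' x)
      ≤ ∫ x in a..b, F' x ^ 2 * Real.exp (-φ x) := by
    apply intervalIntegral.integral_mono_on hab.le (hint _ (by fun_prop)) (hint _ (by fun_prop))
    intro x hx
    have he := Real.exp_pos (-φ x)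
    have : 0 ≤ ((F' x - F x * (c x + φ' x / 2)) ^ 2 + F x ^ 2 * (-φ'' x / 2 + φ' x ^ 2 / 4))
        * Real.exp (-φ x) := by
      have := hneg x hx
      have h3 : 0 ≤ -φ'' x / 2 + φ' x ^ 2 / 4 := by nlinarith [sq_nonneg (φ' x)]
      positivity
    simp only [hW']
    nlinarith
  rw [intervalIntegral.integral_add (hint _ (by fun_prop)) (hint _ hWc'), h0, add_zero] at h1
  exact h1

/-- The weighted Poincaré inequality for mean-zero functions, obtained by duality from
`mul_integral_sq_mul_exp_neg_le`: the primitive `F` of `f exp φ` vanishes at both ends, and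
`∫ f² exp φ = ∫ f F' = -∫ f' F`. -/
theorem mul_integral_sq_mul_exp_le_of_integral_eq_zero {a b k : ℝ} (hab : a < b) (hk : 0 ≤ k)
    (hkab : k * (b - a) < Real.pi) {φ φ' φ'' f f' : ℝ → ℝ}
    (hφ : ∀ x ∈ Icc a b, HasDerivAt φ (φ' x) x) (hφ' : ∀ x ∈ Icc a b, HasDerivAt φ' (φ'' x) x)
    (hφ'' : ContinuousOn φ'' (Icc a b)) (hneg : ∀ x ∈ Icc a b, φ'' x ≤ 0)
    (hf : ∀ x ∈ Icc a b, HasDerivAt f (f' x) x) (hf' : ContinuousOn f' (Icc a b))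
    (h0 : ∫ x in a..b, f x * Real.exp (φ x) = 0) :
    k ^ 2 * ∫ x in a..b, f x ^ 2 * Real.exp (φ x) ≤ ∫ x in a..b, f' x ^ 2 * Real.exp (φ x) := by
  have hφc : ContinuousOn φ (Icc a b) := fun x hx => (hφ x hx).continuousAt.continuousWithinAt
  have hfc : ContinuousOn f (Icc a b) := fun x hx => (hf x hx).continuousAt.continuousWithinAt
  have hint : ∀ g : ℝ → ℝ, ContinuousOn g (Icc a b) → IntervalIntegrable g volume a b := by
    intro g hg
    exact hg.intervalIntegrable_of_Icc hab.le
  set g : ℝ → ℝ := fun x => f x * Real.exp (φ x) with hg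
  have hgc : ContinuousOn g (Icc a b) := by fun_prop
  set F : ℝ → ℝ := fun x => ∫ t in a..x, g t with hF
  have hFc : ContinuousOn F (Icc a b) := by
    have := intervalIntegral.continuousOn_primitive_interval (f := g) (μ := volume)
      (a := a) (b := b) (by rw [uIcc_of_le hab.le]; exact hgc.integrableOn_Icc)
    rwa [uIcc_of_le hab.le] at this
  have hFd : ∀ x ∈ Ioo a b, HasDerivAt F (g x) x := by
    intro x hx
    refine intervalIntegral.integral_hasDerivAt_right
      ((hgc.mono (Icc_subset_Icc_right hx.2.le)).intervalIntegrable_of_Icc hx.1.le) ?_ ?_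
    · exact (hgc.mono Ioo_subset_Icc_self).stronglyMeasurableAtFilter isOpen_Ioo x hx
    · exact (hgc.mono Ioo_subset_Icc_self).continuousAt (isOpen_Ioo.mem_nhds hx)
  have hFa : F a = 0 := by simp [hF]
  have hFb : F b = 0 := h0
  have hw := mul_integral_sq_mul_exp_neg_le hab hk hkab hφ hφ' hφ'' hneg hFc hFd hgc hFa hFb
  have hX : ∫ x in a..b, g x ^ 2 * Real.exp (-φ x) = ∫ x in a..b, f x ^ 2 * Real.exp (φ x) := by
    congr 1
    ext x
    simp only [hg, Real.exp_neg]
    field_simp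
  rw [hX] at hw
  have hibp : ∫ x in a..b, (f' x * F x + f x * g x) = 0 := by
    rw [intervalIntegral.integral_eq_sub_of_hasDerivAt_of_le (f := fun x => f x * F x) hab.le
      (by fun_prop) (fun x hx => (hf x (Ioo_subset_Icc_self hx)).mul (hFd x hx))
      (hint _ (by fun_prop))]
    simp [hFa, hFb]
  rcases hk.eq_or_lt with rfl | hk
  · simp only [ne_eq, OfNat.ofNat_ne_zero, not_false_eq_true, zero_pow, zero_mul]
    apply intervalIntegral.integral_nonneg hab.le
    intro x _
    positivity
  -- Young's inequality for `-2 k² f' F`, arranged as the nonnegativity of a square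
  have hkey : ∫ x in a..b, (2 * k ^ 2 * (f' x * F x + f x * g x))
      ≥ ∫ x in a..b, (2 * k ^ 2 * (f x ^ 2 * Real.exp (φ x)) - f' x ^ 2 * Real.exp (φ x)
        - k ^ 2 * (k ^ 2 * (F x ^ 2 * Real.exp (-φ x)))) := by
    apply intervalIntegral.integral_mono_on hab.le (hint _ (by fun_prop)) (hint _ (by fun_prop))
    intro x hx
    have he := Real.exp_pos (φ x)
    have h1 : 0 ≤ (f' x * Real.exp (φ x) + k ^ 2 * F x) ^ 2 * Real.exp (-φ x) := by positivity
    have h2 : Real.exp (φ x) * Real.exp (-φ x) = 1 := by rw [← Real.exp_add]; simp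
    have h3 : (f' x * Real.exp (φ x) + k ^ 2 * F x) ^ 2 * Real.exp (-φ x)
      = f' x ^ 2 * Real.exp (φ x) * (Real.exp (φ x) * Real.exp (-φ x))
        + 2 * k ^ 2 * f' x * F x * (Real.exp (φ x) * Real.exp (-φ x))
        + k ^ 4 * (F x ^ 2 * Real.exp (-φ x)) := by ring
    rw [h2] at h3
    simp only [hg]
    nlinarith
  rw [intervalIntegral.integral_const_mul, hibp, intervalIntegral.integral_sub,
    intervalIntegral.integral_sub, intervalIntegral.integral_const_mul,
    intervalIntegral.integral_const_mul, intervalIntegral.integral_const_mul] at hkey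
  rotate_left
  · exact hint _ (by fun_prop)
  · exact hint _ (by fun_prop)
  · exact hint _ (by fun_prop)
  · exact hint _ (by fun_prop)
  nlinarith [mul_le_mul_of_nonneg_left hw (sq_nonneg k)]

theorem variance_mul_exp_le {a b k : ℝ} (hab : a < b) (hk : 0 ≤ k)
    (hkab : k * (b - a) < Real.pi) {φ φ' φ'' f f' : ℝ → ℝ}
    (hφ : ∀ x ∈ Icc a b, HasDerivAt φ (φ' x) x) (hφ' : ∀ x ∈ Icc a b, HasDerivAt φ' (φ'' x) x)
    (hφ'' : ContinuousOn φ'' (Icc a b)) (hneg : ∀ x ∈ Icc a b, φ'' x ≤ 0)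
    (hf : ∀ x ∈ Icc a b, HasDerivAt f (f' x) x) (hf' : ContinuousOn f' (Icc a b)) :
    k ^ 2 * ((∫ x in a..b, Real.exp (φ x)) * (∫ x in a..b, f x ^ 2 * Real.exp (φ x))
        - (∫ x in a..b, f x * Real.exp (φ x)) ^ 2)
      ≤ (∫ x in a..b, Real.exp (φ x)) * ∫ x in a..b, f' x ^ 2 * Real.exp (φ x) := by
  have hφc : ContinuousOn φ (Icc a b) := fun x hx => (hφ x hx).continuousAt.continuousWithinAt
  have hfc : ContinuousOn f (Icc a b) := fun x hx => (hf x hx).continuousAt.continuousWithinAt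
  have hint : ∀ g : ℝ → ℝ, ContinuousOn g (Icc a b) → IntervalIntegrable g volume a b := by
    intro g hg
    exact hg.intervalIntegrable_of_Icc hab.le
  set m := ∫ x in a..b, Real.exp (φ x)
  set m1 := ∫ x in a..b, f x * Real.exp (φ x) with hm1
  set X := ∫ x in a..b, f x ^ 2 * Real.exp (φ x)
  have hm : 0 < m := intervalIntegral.intervalIntegral_pos_of_pos_on (hint _ (by fun_prop))
    (fun x _ => Real.exp_pos _) hab
  have e1 : ∫ x in a..b, (f x - m1 / m) * Real.exp (φ x) = 0 := by
    simp_rw [sub_mul]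
    rw [intervalIntegral.integral_sub (hint _ (by fun_prop)) (hint _ (by fun_prop)),
      intervalIntegral.integral_const_mul]
    field_simp
    ring
  have e2 : ∫ x in a..b, (f x - m1 / m) ^ 2 * Real.exp (φ x) = X - m1 ^ 2 / m := by
    have : ∀ x, (f x - m1 / m) ^ 2 * Real.exp (φ x) = f x ^ 2 * Real.exp (φ x)
      - 2 * (m1 / m) * (f x * Real.exp (φ x)) + (m1 / m) ^ 2 * Real.exp (φ x) := by intro x; ring
    simp_rw [this]
    rw [intervalIntegral.integral_add (hint _ (by fun_prop)) (hint _ (by fun_prop)),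
      intervalIntegral.integral_sub (hint _ (by fun_prop)) (hint _ (by fun_prop)),
      intervalIntegral.integral_const_mul, intervalIntegral.integral_const_mul]
    field_simp
    ring
  have := mul_integral_sq_mul_exp_le_of_integral_eq_zero hab hk hkab hφ hφ' hφ'' hneg
    (f := fun x => f x - m1 / m) (fun x hx => (hf x hx).sub_const _) hf' e1
  rw [e2] at this
  calc k ^ 2 * (m * X - m1 ^ 2) = m * (k ^ 2 * (X - m1 ^ 2 / m)) := by field_simp
    _ ≤ _ := by gcongr

/-! ### Concave exponents without smoothness -/

theorem exists_hasDerivAt_of_continuousOn_Ioo {a b : ℝ} {g : ℝ → ℝ} 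
    (hg : ContinuousOn g (Ioo a b)) :
    ∃ G : ℝ → ℝ, ∀ x ∈ Ioo a b, HasDerivAt G (g x) x := by
  refine ⟨fun x => ∫ t in (a + b) / 2..x, g t, fun x hx => ?_⟩
  have hm : (a + b) / 2 ∈ Ioo a b := by
    constructor <;> linarith [hx.1, hx.2]
  refine intervalIntegral.integral_hasDerivAt_right
    ((hg.mono (ordConnected_Ioo.uIcc_subset hm hx)).intervalIntegrable) ?_ ?_
  · exact hg.stronglyMeasurableAtFilter isOpen_Ioo x hx
  · exact hg.continuousAt (isOpen_Ioo.mem_nhds hx)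

/-- A second difference quotient of a second antiderivative of `g` is a value of `g`. -/
theorem exists_eq_second_difference {a b x h : ℝ} {g G₁ G₂ : ℝ → ℝ}
    (h₁ : ∀ x ∈ Ioo a b, HasDerivAt G₁ (g x) x) (h₂ : ∀ x ∈ Ioo a b, HasDerivAt G₂ (G₁ x) x)
    (hh : 0 < h) (hax : a < x) (hxb : x + 2 * h < b) :
    ∃ ζ ∈ Icc x (x + 2 * h), (G₂ (x + 2 * h) - 2 * G₂ (x + h) + G₂ x) / h ^ 2 = g ζ := by
  have hd : ∀ y ∈ Icc x (x + h), HasDerivAt (fun t => G₂ (t + h) - G₂ t) (G₁ (y + h) - G₁ y) y := by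
    intro y hy
    refine HasDerivAt.sub ?_ (h₂ y ⟨by linarith [hy.1], by linarith [hy.2]⟩)
    exact HasDerivAt.comp_add_const y h (h₂ (y + h) ⟨by linarith [hy.1], by linarith [hy.2]⟩)
  obtain ⟨ξ, hξ, e1⟩ := exists_hasDerivAt_eq_slope (fun t => G₂ (t + h) - G₂ t)
    (fun y => G₁ (y + h) - G₁ y) (a := x) (b := x + h) (by linarith)
    (fun y hy => (hd y hy).continuousAt.continuousWithinAt)
    (fun y hy => hd y (Ioo_subset_Icc_self hy))
  have hd1 : ∀ y ∈ Icc ξ (ξ + h), HasDerivAt G₁ (g y) y := fun y hy =>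
    h₁ y ⟨by linarith [hy.1, hξ.1], by linarith [hy.2, hξ.2]⟩
  obtain ⟨ζ, hζ, e2⟩ := exists_hasDerivAt_eq_slope G₁ g (a := ξ) (b := ξ + h) (by linarith)
    (fun y hy => (hd1 y hy).continuousAt.continuousWithinAt)
    (fun y hy => hd1 y (Ioo_subset_Icc_self hy))
  refine ⟨ζ, ⟨by linarith [hζ.1, hξ.1], by linarith [hζ.2, hξ.2]⟩, ?_⟩
  have hne := hh.ne'
  have : x + 2 * h = x + h + h := by ring
  rw [e2, e1, this, add_sub_cancel_left, add_sub_cancel_left]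
  field_simp
  ring

/-- The Poincaré inequality with weight `exp φ` for `φ` concave and bounded above on `(a, b)`. The
exponent is approximated on slightly smaller intervals by the second difference quotients `ψ n` of a
second antiderivative `G₂` of `φ`: their second derivatives are second difference quotients of `φ`
itself, hence nonpositive, and their values are values of `φ` at nearby points. -/
theorem variance_mul_exp_le_of_concaveOn {a b k C : ℝ} (hab : a < b) (hk : 0 ≤ k)
    (hkab : k * (b - a) < Real.pi) {φ f f' : ℝ → ℝ} (hφ : ConcaveOn ℝ (Ioo a b) φ)
    (hC : ∀ x ∈ Ioo a b, φ x ≤ C) (hf : ∀ x, HasDerivAt f (f' x) x) (hf' : Continuous f') :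
    k ^ 2 * ((∫ x in Ioo a b, Real.exp (φ x)) * (∫ x in Ioo a b, f x ^ 2 * Real.exp (φ x))
        - (∫ x in Ioo a b, f x * Real.exp (φ x)) ^ 2)
      ≤ (∫ x in Ioo a b, Real.exp (φ x)) * ∫ x in Ioo a b, f' x ^ 2 * Real.exp (φ x) := by
  have hφc : ContinuousOn φ (Ioo a b) := hφ.continuousOn isOpen_Ioo
  have hfc : Continuous f := continuous_iff_continuousAt.2 fun x => (hf x).continuousAt
  obtain ⟨G₁, hG₁⟩ := exists_hasDerivAt_of_continuousOn_Ioo hφc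
  obtain ⟨G₂, hG₂⟩ := exists_hasDerivAt_of_continuousOn_Ioo (a := a) (b := b) (g := G₁)
    (fun x hx => (hG₁ x hx).continuousAt.continuousWithinAt)
  -- the step of the second differences
  set h : ℕ → ℝ := fun n => (b - a) / (n + 5) with hh
  have hh0 : ∀ n, 0 < h n := fun n => by
    have : 0 < b - a := by linarith
    positivity
  have hh5 : ∀ n, 5 * h n ≤ b - a := by
    intro n
    have h1 : h n * (n + 5) = b - a := by
      simp only [hh]
      field_simp
    nlinarith [hh0 n, (Nat.cast_nonneg n : (0 : ℝ) ≤ n)]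
  have hhlim : Filter.Tendsto h Filter.atTop (nhds 0) := by
    apply Filter.Tendsto.div_atTop tendsto_const_nhds
    exact Filter.tendsto_atTop_add_const_right _ _ tendsto_natCast_atTop_atTop
  set ψ : ℕ → ℝ → ℝ := fun n x => (G₂ (x + 2 * h n) - 2 * G₂ (x + h n) + G₂ x) / h n ^ 2 with hψ
  set ψ'' : ℕ → ℝ → ℝ := fun n x => (φ (x + 2 * h n) - 2 * φ (x + h n) + φ x) / h n ^ 2 with hψ''
  set A : ℕ → ℝ := fun n => a + h n with hA
  set B : ℕ → ℝ := fun n => b - 3 * h n with hB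
  have hAB : ∀ n, A n < B n := fun n => by
    simp only [hA, hB]
    linarith [hh0 n, hh5 n]
  have hmem : ∀ n, ∀ x ∈ Icc (A n) (B n),
      x ∈ Ioo a b ∧ x + h n ∈ Ioo a b ∧ x + 2 * h n ∈ Ioo a b := by
    intro n x hx
    have := hh0 n
    simp only [hA, hB, mem_Icc] at hx
    refine ⟨⟨?_, ?_⟩, ⟨?_, ?_⟩, ⟨?_, ?_⟩⟩ <;> linarith [hx.1, hx.2]
  have hd : ∀ (g g' : ℝ → ℝ), (∀ x ∈ Ioo a b, HasDerivAt g (g' x) x) → ∀ n, ∀ x ∈ Icc (A n) (B n),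
      HasDerivAt (fun x => (g (x + 2 * h n) - 2 * g (x + h n) + g x) / h n ^ 2)
        ((g' (x + 2 * h n) - 2 * g' (x + h n) + g' x) / h n ^ 2) x := by
    intro g g' hg n x hx
    obtain ⟨h1, h2, h3⟩ := hmem n x hx
    exact ((((hg _ h3).comp_add_const x _).sub (((hg _ h2).comp_add_const x _).const_mul 2)).add
      (hg _ h1)).div_const _
  have hψ''c : ∀ n, ContinuousOn (ψ'' n) (Icc (A n) (B n)) := by
    intro n
    have h1 : ∀ s : ℝ, (∀ x ∈ Icc (A n) (B n), x + s ∈ Ioo a b) →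
        ContinuousOn (fun x => φ (x + s)) (Icc (A n) (B n)) := fun s hs =>
      hφc.comp (by fun_prop) hs
    refine ContinuousOn.div_const ((ContinuousOn.sub (h1 _ fun x hx => (hmem n x hx).2.2)
      ((h1 _ fun x hx => (hmem n x hx).2.1).const_mul 2)).add
      (hφc.mono fun x hx => (hmem n x hx).1)) _
  have hψ''neg : ∀ n, ∀ x ∈ Icc (A n) (B n), ψ'' n x ≤ 0 := by
    intro n x hx
    obtain ⟨h1, h2, h3⟩ := hmem n x hx
    have := hφ.2 h1 h3 (by norm_num : (0 : ℝ) ≤ 1 / 2) (by norm_num : (0 : ℝ) ≤ 1 / 2) (by norm_num)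
    simp only [smul_eq_mul] at this
    have e : 1 / 2 * x + 1 / 2 * (x + 2 * h n) = x + h n := by ring
    rw [e] at this
    apply div_nonpos_of_nonpos_of_nonneg _ (by positivity)
    linarith
  have hζ : ∀ n, ∀ x ∈ Icc (A n) (B n), ∃ ζ ∈ Icc x (x + 2 * h n), ψ n x = φ ζ := by
    intro n x hx
    obtain ⟨h1, h2, h3⟩ := hmem n x hx
    exact exists_eq_second_difference hG₁ hG₂ (hh0 n) h1.1 h3.2
  have hψC : ∀ n, ∀ x ∈ Icc (A n) (B n), ψ n x ≤ C := by
    intro n x hx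
    obtain ⟨ζ, hζ1, hζ2⟩ := hζ n x hx
    rw [hζ2]
    exact hC _ ⟨by linarith [hζ1.1, (hmem n x hx).1.1], by linarith [hζ1.2, (hmem n x hx).2.2.2]⟩
  have hev : ∀ x ∈ Ioo a b, ∀ᶠ n in Filter.atTop, x ∈ Ioc (A n) (B n) := by
    intro x hx
    have h1 : ∀ᶠ n in Filter.atTop, h n < (x - a) :=
      hhlim.eventually_lt_const (by linarith [hx.1])
    have h2 : ∀ᶠ n in Filter.atTop, h n < (b - x) / 3 :=
      hhlim.eventually_lt_const (by linarith [hx.2])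
    filter_upwards [h1, h2] with n hn1 hn2
    exact ⟨by simp only [hA]; linarith, by simp only [hB]; linarith⟩
  have hψlim : ∀ x ∈ Ioo a b, Filter.Tendsto (fun n => ψ n x) Filter.atTop (nhds (φ x)) := by
    intro x hx
    have hcx := hφc.continuousAt (isOpen_Ioo.mem_nhds hx)
    rw [Metric.tendsto_atTop]
    intro ε hε
    obtain ⟨τ, hτ, hτ'⟩ := Metric.continuousAt_iff.1 hcx ε hε
    have h1 : ∀ᶠ n in Filter.atTop, h n < τ / 2 := hhlim.eventually_lt_const (by linarith)
    obtain ⟨N, hN⟩ := ((hev x hx).and h1).exists_forall_of_atTop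
    refine ⟨N, fun n hn => ?_⟩
    obtain ⟨h2, h3⟩ := hN n hn
    obtain ⟨ζ, hζ1, hζ2⟩ := hζ n x (Ioc_subset_Icc_self h2)
    rw [hζ2]
    apply hτ'
    rw [Real.dist_eq, abs_of_nonneg (by linarith [hζ1.1])]
    linarith [hζ1.2]
  have hlim : ∀ g : ℝ → ℝ, Continuous g → Filter.Tendsto
      (fun n => ∫ x in A n..B n, g x * Real.exp (ψ n x)) Filter.atTop
      (nhds (∫ x in Ioo a b, g x * Real.exp (φ x))) := by
    intro g hg
    have e : ∀ n, ∫ x in A n..B n, g x * Real.exp (ψ n x)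
        = ∫ x in Ioo a b, (Ioc (A n) (B n)).indicator (fun x => g x * Real.exp (ψ n x)) x := by
      intro n
      rw [intervalIntegral.integral_of_le (hAB n).le, setIntegral_indicator measurableSet_Ioc,
        inter_eq_right.2 fun x hx => (hmem n x (Ioc_subset_Icc_self hx)).1]
    simp_rw [e]
    apply tendsto_integral_of_dominated_convergence (fun x => |g x| * Real.exp C)
    · intro n
      have hψc : ContinuousOn (ψ n) (Ioc (A n) (B n)) := fun x hx =>
        (hd _ _ hG₂ n x (Ioc_subset_Icc_self hx)).continuousAt.continuousWithinAt
      exact ((aestronglyMeasurable_indicator_iff measurableSet_Ioc).2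
        (ContinuousOn.aestronglyMeasurable (by fun_prop) measurableSet_Ioc)).mono_measure
          Measure.restrict_le_self
    · exact ((by fun_prop : Continuous fun x => |g x| * Real.exp C).integrableOn_Icc).mono_set
        Ioo_subset_Icc_self
    · intro n
      refine Filter.Eventually.of_forall fun x => ?_
      by_cases hx : x ∈ Ioc (A n) (B n)
      · rw [indicator_of_mem hx, norm_mul, Real.norm_eq_abs, Real.norm_eq_abs, Real.abs_exp]
        gcongr
        exact hψC n x (Ioc_subset_Icc_self hx)
      · rw [indicator_of_notMem hx, norm_zero]
        positivity
    · refine (ae_restrict_iff' measurableSet_Ioo).2 (Filter.Eventually.of_forall fun x hx => ?_)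
      have h1 : Filter.Tendsto (fun n => g x * Real.exp (ψ n x)) Filter.atTop
        (nhds (g x * Real.exp (φ x))) := ((Real.continuous_exp.tendsto _).comp (hψlim x hx)).const_mul _
      refine h1.congr' ?_
      filter_upwards [hev x hx] with n hn
      rw [indicator_of_mem hn]
  have hlim1 := hlim (fun _ => 1) continuous_const
  simp only [one_mul] at hlim1
  refine le_of_tendsto_of_tendsto' ((((hlim1.mul (hlim _ (hfc.pow 2))).sub
    ((hlim _ hfc).pow 2))).const_mul (k ^ 2)) (hlim1.mul (hlim _ (hf'.pow 2))) fun n => ?_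
  refine variance_mul_exp_le (hAB n) hk (lt_of_le_of_lt ?_ hkab) (hd _ _ hG₂ n) (hd _ _ hG₁ n)
    (hψ''c n) (hψ''neg n) (fun x _ => hf x) hf'.continuousOn
  gcongr
  · simp only [hB]
    linarith [hh0 n]
  · simp only [hA]
    linarith [hh0 n]

/-! ### Log-concave weights and the sharp Poincaré inequality -/

/-- A bounded measurable log-concave function `p ≥ 0` on `E` whose support has diameter at most
`D`. The function is allowed to vanish, so that its support plays the role of a convex domain. -/
structure IsLogConcaveWeight {E : Type*} [NormedAddCommGroup E] [NormedSpace ℝ E]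
    [MeasurableSpace E] (D : ℝ) (p : E → ℝ) : Prop where
  measurable : Measurable p
  nonneg : ∀ x, 0 ≤ p x
  bddAbove : ∃ C, ∀ x, p x ≤ C
  rpow_mul_rpow_le : ∀ (x y : E) (t : ℝ), 0 < t → t < 1 → p x ^ (1 - t) * p y ^ t ≤ p ((1 - t) • x + t • y)
  dist_le : ∀ x y, p x ≠ 0 → p y ≠ 0 → dist x y ≤ D

/-- The variance form of the weighted Poincaré inequality on `E`, with the sharp constant: for every
weight `p` with support of diameter at most `D` and every `k ≥ 0` with `k D < π`, `k²` times the
variance of `f` with respect to `p` is at most the integral of `|∇f|²` (both multiplied by the mass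
of `p`, which makes the statement homogeneous and meaningful for `p = 0`). Asking for `k D < π`
instead of `k = π / D` covers the case `D = 0`. -/
def SharpPoincare (E : Type*) [NormedAddCommGroup E] [InnerProductSpace ℝ E]
    [MeasureSpace E] : Prop :=
  ∀ (D : ℝ) (p : E → ℝ), IsLogConcaveWeight D p → ∀ f : E → ℝ, ContDiff ℝ 1 f →
    ∀ k : ℝ, 0 ≤ k → k * D < Real.pi →
      k ^ 2 * ((∫ x, p x) * (∫ x, f x ^ 2 * p x) - (∫ x, f x * p x) ^ 2)
        ≤ (∫ x, p x) * ∫ x, ‖fderiv ℝ f x‖ ^ 2 * p x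

namespace IsLogConcaveWeight

section
variable {E : Type*} [NormedAddCommGroup E] [NormedSpace ℝ E] [MeasurableSpace E] {D : ℝ}
  {p : E → ℝ}

theorem pos_of_ne_zero (hp : IsLogConcaveWeight D p) {x : E} (hx : p x ≠ 0) : 0 < p x :=
  (hp.nonneg x).lt_of_ne' hx

theorem convex_support (hp : IsLogConcaveWeight D p) : Convex ℝ (Function.support p) := by
  rw [convex_iff_forall_pos]
  intro x hx y hy a b ha hb hab
  have h := hp.rpow_mul_rpow_le x y b hb (by linarith)
  have ha' : 1 - b = a := by linarith
  rw [ha'] at h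
  have h1 := Real.rpow_pos_of_pos (hp.pos_of_ne_zero hx) a
  have h2 := Real.rpow_pos_of_pos (hp.pos_of_ne_zero hy) b
  exact (lt_of_lt_of_le (mul_pos h1 h2) h).ne'

theorem exists_support_subset_closedBall (hp : IsLogConcaveWeight D p) :
    ∃ z R, Function.support p ⊆ Metric.closedBall z R := by
  rcases (Function.support p).eq_empty_or_nonempty with h | ⟨z, hz⟩
  · exact ⟨0, 0, by simp [h]⟩
  · exact ⟨z, D, fun x hx => hp.dist_le x z hx hz⟩

theorem indicator (hp : IsLogConcaveWeight D p) {S : Set E} (hS : Convex ℝ S)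
    (hSm : MeasurableSet S) : IsLogConcaveWeight D (S.indicator p) where
  measurable := hp.measurable.indicator hSm
  nonneg := fun x => indicator_nonneg (fun x _ => hp.nonneg x) x
  bddAbove := by
    obtain ⟨C, hC⟩ := hp.bddAbove
    exact ⟨C, fun x => (indicator_le_self' (fun x _ => hp.nonneg x) x).trans (hC x)⟩
  rpow_mul_rpow_le := by
    intro x y t ht ht1
    have h0 : 0 ≤ S.indicator p ((1 - t) • x + t • y) :=
      indicator_nonneg (fun x _ => hp.nonneg x) _
    by_cases hx : x ∈ S
    · by_cases hy : y ∈ S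
      · rw [indicator_of_mem hx, indicator_of_mem hy,
          indicator_of_mem (hS hx hy (by linarith) ht.le (by ring))]
        exact hp.rpow_mul_rpow_le x y t ht ht1
      · rwa [indicator_of_notMem hy, Real.zero_rpow ht.ne', mul_zero]
    · rwa [indicator_of_notMem hx, Real.zero_rpow (by linarith), zero_mul]
  dist_le := fun x y hx hy => hp.dist_le x y
    (fun h => hx (by simp [h])) (fun h => hy (by simp [h]))

theorem integrable_mul [BorelSpace E] [FiniteDimensional ℝ E]
    {μ : Measure E} [IsFiniteMeasureOnCompacts μ] (hp : IsLogConcaveWeight D p) {g : E → ℝ}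
    (hg : Continuous g) : Integrable (fun x => g x * p x) μ := by
  obtain ⟨z, R, hzR⟩ := hp.exists_support_subset_closedBall
  obtain ⟨C, hC⟩ := hp.bddAbove
  have : ProperSpace E := FiniteDimensional.proper ℝ E
  have h1 : IntegrableOn (fun x => g x * p x) (Metric.closedBall z R) μ := by
    refine Integrable.mono' ((hg.norm.mul continuous_const :
      Continuous fun x => ‖g x‖ * C).continuousOn.integrableOn_compact (isCompact_closedBall z R))
      (hg.aestronglyMeasurable.mul hp.measurable.aestronglyMeasurable) ?_
    refine Filter.Eventually.of_forall fun x => ?_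
    rw [norm_mul, Real.norm_of_nonneg (hp.nonneg x)]
    exact mul_le_mul_of_nonneg_left (hC x) (norm_nonneg _)
  refine (integrableOn_iff_integrable_of_support_subset ?_).1 h1
  intro x hx
  exact hzR (right_ne_zero_of_mul hx)

theorem integrable [BorelSpace E] [FiniteDimensional ℝ E]
    {μ : Measure E} [IsFiniteMeasureOnCompacts μ] (hp : IsLogConcaveWeight D p) :
    Integrable p μ := by
  simpa using hp.integrable_mul (μ := μ) (g := fun _ => 1) continuous_const

theorem comp_linearIsometryEquiv {F : Type*} [NormedAddCommGroup F] [NormedSpace ℝ F]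
    [MeasurableSpace F] [BorelSpace E] [BorelSpace F] (hp : IsLogConcaveWeight D p)
    (U : F ≃ₗᵢ[ℝ] E) : IsLogConcaveWeight D (p ∘ U) where
  measurable := hp.measurable.comp U.continuous.measurable
  nonneg := fun x => hp.nonneg _
  bddAbove := by
    obtain ⟨C, hC⟩ := hp.bddAbove
    exact ⟨C, fun x => hC _⟩
  rpow_mul_rpow_le := by
    intro x y t ht ht1
    simpa using hp.rpow_mul_rpow_le (U x) (U y) t ht ht1
  dist_le := fun x y hx hy => by
    simpa using hp.dist_le _ _ hx hy

end

theorem concaveOn_log {D : ℝ} {p : ℝ → ℝ} (hp : IsLogConcaveWeight D p) :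
    ConcaveOn ℝ (Function.support p) (fun x => Real.log (p x)) := by
  rw [concaveOn_iff_forall_pos]
  refine ⟨hp.convex_support, ?_⟩
  intro x hx y hy a b ha hb hab
  have h := hp.rpow_mul_rpow_le x y b hb (by linarith)
  have ha' : 1 - b = a := by linarith
  rw [ha'] at h
  have hx := hp.pos_of_ne_zero hx
  have hy := hp.pos_of_ne_zero hy
  have h1 := Real.rpow_pos_of_pos hx a
  have h2 := Real.rpow_pos_of_pos hy b
  have h3 := Real.log_le_log (mul_pos h1 h2) h
  rwa [Real.log_mul h1.ne' h2.ne', Real.log_rpow hx, Real.log_rpow hy] at h3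

end IsLogConcaveWeight

theorem sharpPoincare_real : SharpPoincare ℝ := by
  intro D p hp f hf k hk hkD
  have hfc : Continuous (deriv f) := hf.continuous_deriv (by simp)
  have hnorm : ∀ x, ‖fderiv ℝ f x‖ ^ 2 = deriv f x ^ 2 := by
    intro x
    rw [← norm_deriv_eq_norm_fderiv, Real.norm_eq_abs, sq_abs]
  simp_rw [hnorm]
  set S := Function.support p with hS
  have hSc : S.OrdConnected := hp.convex_support.ordConnected
  obtain ⟨z, R, hzR⟩ := hp.exists_support_subset_closedBall
  have hbb : BddBelow S := ((Metric.isBounded_closedBall).subset hzR).bddBelow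
  have hba : BddAbove S := ((Metric.isBounded_closedBall).subset hzR).bddAbove
  rcases S.eq_empty_or_nonempty with hne | hne
  · have : p = 0 := Function.support_eq_empty_iff.1 hne
    simp [this]
  set a := sInf S
  set b := sSup S
  have hsub : S ⊆ Icc a b := fun x hx => ⟨csInf_le hbb hx, le_csSup hba hx⟩
  have hsup : Ioo a b ⊆ S := by
    intro x hx
    obtain ⟨y, hy, hyx⟩ := exists_lt_of_csInf_lt hne hx.1
    obtain ⟨w, hw, hwx⟩ := exists_lt_of_lt_csSup hne hx.2
    exact hSc.out hy hw ⟨hyx.le, hwx.le⟩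
  have hint : ∀ g : ℝ → ℝ, ∫ x, g x * p x = ∫ x in Ioo a b, g x * p x := by
    intro g
    rw [← integral_Icc_eq_integral_Ioo, setIntegral_eq_integral_of_forall_compl_eq_zero]
    intro x hx
    have : p x = 0 := by
      by_contra h
      exact hx (hsub h)
    rw [this, mul_zero]
  have hint1 := hint (fun _ => 1)
  simp only [one_mul] at hint1
  rw [hint1, hint, hint, hint]
  rcases (csInf_le_csSup hne hbb hba : a ≤ b).eq_or_lt with hab | hab
  · simp [Ioo_eq_empty (show ¬ a < b from not_lt.2 (show b ≤ a from hab.ge))]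
  have hexp : ∀ g : ℝ → ℝ, ∫ x in Ioo a b, g x * p x
      = ∫ x in Ioo a b, g x * Real.exp (Real.log (p x)) := by
    intro g
    refine setIntegral_congr_fun measurableSet_Ioo fun x hx => ?_
    rw [Real.exp_log (hp.pos_of_ne_zero (hsup hx))]
  have hexp1 := hexp (fun _ => 1)
  simp only [one_mul] at hexp1
  rw [hexp1, hexp, hexp, hexp]
  obtain ⟨C, hC⟩ := hp.bddAbove
  have hab' : b - a ≤ D := by
    by_contra! hlt
    set τ := (b - a - D) / 3 with hτ
    have hD : 0 ≤ D := by
      obtain ⟨y, hy⟩ := hne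
      simpa using hp.dist_le y y hy hy
    have h := hp.dist_le (b - τ) (a + τ) (hsup ⟨by linarith, by linarith⟩)
      (hsup ⟨by linarith, by linarith⟩)
    rw [Real.dist_eq] at h
    have := le_abs_self (b - τ - (a + τ))
    linarith
  refine variance_mul_exp_le_of_concaveOn (C := Real.log C) hab hk (lt_of_le_of_lt ?_ hkD)
    (hp.concaveOn_log.subset hsup (convex_Ioo a b)) ?_
    (fun x => (hf.differentiable (by simp) x).hasDerivAt) hfc
  · gcongr
  · intro x hx
    exact Real.log_le_log (hp.pos_of_ne_zero (hsup hx)) (hC x)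

theorem SharpPoincare.of_linearIsometryEquiv {E F : Type*} [NormedAddCommGroup E]
    [InnerProductSpace ℝ E] [NormedAddCommGroup F] [InnerProductSpace ℝ F]
    [FiniteDimensional ℝ E] [FiniteDimensional ℝ F]
    [MeasurableSpace E] [BorelSpace E] [MeasurableSpace F] [BorelSpace F]
    (hF : SharpPoincare F) (U : F ≃ₗᵢ[ℝ] E) : SharpPoincare E := by
  intro D p hp f hf k hk hkD
  have h := hF D _ (hp.comp_linearIsometryEquiv U) (f ∘ U) (hf.comp U.contDiff) k hk hkD
  have hU := U.measurePreserving
  have he : MeasurableEmbedding U := U.toHomeomorph.measurableEmbedding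
  have hn : ∀ x, ‖fderiv ℝ (f ∘ U) x‖ = ‖fderiv ℝ f (U x)‖ := by
    intro x
    have h1 := U.toContinuousLinearEquiv.comp_right_fderiv (f := f) (x := x)
    have h2 : fderiv ℝ (f ∘ U) x = (fderiv ℝ f (U x)).comp (U : F →L[ℝ] E) := h1
    rw [h2]
    exact ContinuousLinearMap.opNorm_comp_linearIsometryEquiv _ U
  simp_rw [hn] at h
  have hi : ∀ g : E → ℝ, ∫ x, g (U x) = ∫ y, g y := fun g => hU.integral_comp he g
  simp only [Function.comp_apply] at h
  rwa [hi p, hi (fun y => f y ^ 2 * p y), hi (fun y => f y * p y),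
    hi (fun y => ‖fderiv ℝ f y‖ ^ 2 * p y)] at h

/-! ### Marginals of log-concave weights -/

open scoped Pointwise in
/-- The one-dimensional Brunn–Minkowski inequality, for convex sets. -/
theorem volume_convex_combination_ge {A B C : Set ℝ} {t : ℝ} (ht : 0 < t) (ht1 : t < 1)
    (hA : Convex ℝ A) (hB : Convex ℝ B) (hAn : A.Nonempty) (hBn : B.Nonempty)
    (hAb : Bornology.IsBounded A) (hBb : Bornology.IsBounded B)
    (h : ∀ a ∈ A, ∀ b ∈ B, (1 - t) * a + t * b ∈ C) :
    ENNReal.ofReal (1 - t) * volume A + ENNReal.ofReal t * volume B ≤ volume C := by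
  have hvol : ∀ S : Set ℝ, S.Nonempty → Bornology.IsBounded S →
      volume S ≤ ENNReal.ofReal (sSup S - sInf S) := by
    intro S _ hSb
    rw [← Real.volume_Icc]
    exact measure_mono fun x hx => ⟨csInf_le hSb.bddBelow hx, le_csSup hSb.bddAbove hx⟩
  have h1t : 0 ≤ 1 - t := by linarith
  set S : Set ℝ := (1 - t) • A + t • B with hS
  have hSc : Convex ℝ S := (hA.smul _).add (hB.smul _)
  have hSn : S.Nonempty := hAn.smul_set.add hBn.smul_set
  have hbA : BddBelow ((1 - t) • A) := hAb.bddBelow.smul_of_nonneg h1t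
  have hbB : BddBelow (t • B) := hBb.bddBelow.smul_of_nonneg ht.le
  have haA : BddAbove ((1 - t) • A) := hAb.bddAbove.smul_of_nonneg h1t
  have haB : BddAbove (t • B) := hBb.bddAbove.smul_of_nonneg ht.le
  have hinf : sInf S = (1 - t) * sInf A + t * sInf B := by
    rw [hS, csInf_add hAn.smul_set hbA hBn.smul_set hbB, Real.sInf_smul_of_nonneg h1t,
      Real.sInf_smul_of_nonneg ht.le, smul_eq_mul, smul_eq_mul]
  have hsup : sSup S = (1 - t) * sSup A + t * sSup B := by
    rw [hS, csSup_add hAn.smul_set haA hBn.smul_set haB, Real.sSup_smul_of_nonneg h1t,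
      Real.sSup_smul_of_nonneg ht.le, smul_eq_mul, smul_eq_mul]
  have hsub : Ioo (sInf S) (sSup S) ⊆ C := by
    intro x hx
    obtain ⟨y, hy, hyx⟩ := exists_lt_of_csInf_lt hSn hx.1
    obtain ⟨w, hw, hwx⟩ := exists_lt_of_lt_csSup hSn hx.2
    obtain ⟨u, ⟨a, ha, rfl⟩, v, ⟨b, hb, rfl⟩, rfl⟩ := hSc.ordConnected.out hy hw ⟨hyx.le, hwx.le⟩
    exact h a ha b hb
  have hA0 : sInf A ≤ sSup A := csInf_le_csSup hAn hAb.bddBelow hAb.bddAbove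
  have hB0 : sInf B ≤ sSup B := csInf_le_csSup hBn hBb.bddBelow hBb.bddAbove
  calc ENNReal.ofReal (1 - t) * volume A + ENNReal.ofReal t * volume B
      ≤ ENNReal.ofReal (1 - t) * ENNReal.ofReal (sSup A - sInf A)
        + ENNReal.ofReal t * ENNReal.ofReal (sSup B - sInf B) := by
        gcongr
        · exact hvol A hAn hAb
        · exact hvol B hBn hBb
    _ = ENNReal.ofReal (sSup S - sInf S) := by
        rw [← ENNReal.ofReal_mul h1t, ← ENNReal.ofReal_mul ht.le, ← ENNReal.ofReal_add, hinf, hsup]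
        · congr 1
          ring
        · exact mul_nonneg h1t (by linarith)
        · exact mul_nonneg ht.le (by linarith)
    _ = volume (Ioo (sInf S) (sSup S)) := by rw [Real.volume_Ioo]
    _ ≤ volume C := measure_mono hsub

namespace IsLogConcaveWeight

theorem convex_superlevel {E : Type*} [NormedAddCommGroup E] [NormedSpace ℝ E] [MeasurableSpace E]
    {D : ℝ} {p : E → ℝ} (hp : IsLogConcaveWeight D p) {c : ℝ} (hc : 0 < c) :
    Convex ℝ {x | c < p x} := by
  rw [convex_iff_forall_pos]
  intro x hx y hy a b ha hb hab
  have h := hp.rpow_mul_rpow_le x y b hb (by linarith)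
  have ha' : 1 - b = a := by linarith
  rw [ha'] at h
  refine lt_of_lt_of_le ?_ h
  calc c = c ^ a * c ^ b := by rw [← Real.rpow_add hc, hab, Real.rpow_one]
    _ < p x ^ a * p y ^ b := by
      apply mul_lt_mul'' _ _ (by positivity) (by positivity)
      · exact Real.rpow_lt_rpow hc.le hx ha
      · exact Real.rpow_lt_rpow hc.le hy hb

theorem exists_isLUB {E : Type*} [NormedAddCommGroup E] [NormedSpace ℝ E] [MeasurableSpace E]
    {D : ℝ} {p : E → ℝ} (hp : IsLogConcaveWeight D p) {x : E} (hx : p x ≠ 0) :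
    ∃ M, 0 < M ∧ (∀ y, p y ≤ M) ∧ ∀ c < M, ∃ y, c < p y := by
  obtain ⟨C, hC⟩ := hp.bddAbove
  have hb : BddAbove (range p) := ⟨C, by rintro _ ⟨y, rfl⟩; exact hC y⟩
  refine ⟨sSup (range p), ?_, fun y => le_csSup hb ⟨y, rfl⟩, fun c hc => ?_⟩
  · exact (hp.pos_of_ne_zero hx).trans_le (le_csSup hb ⟨x, rfl⟩)
  · obtain ⟨_, ⟨y, rfl⟩, hy⟩ := exists_lt_of_lt_csSup (range_nonempty_iff_nonempty.2 ⟨x⟩) hc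
    exact ⟨y, hy⟩

theorem isBounded_superlevel {E : Type*} [NormedAddCommGroup E] [NormedSpace ℝ E]
    [MeasurableSpace E] {D : ℝ} {p : E → ℝ} (hp : IsLogConcaveWeight D p) {c : ℝ} (hc : 0 < c) :
    Bornology.IsBounded {x | c < p x} := by
  obtain ⟨z, R, h⟩ := hp.exists_support_subset_closedBall
  exact Metric.isBounded_closedBall.subset (Subset.trans (fun x hx => (hc.trans hx).ne') h)

theorem lintegral_div_eq {D : ℝ} {p : ℝ → ℝ} (hp : IsLogConcaveWeight D p) {M : ℝ} (hM : 0 < M)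
    (hpM : ∀ y, p y ≤ M) :
    ∫⁻ x, ENNReal.ofReal (p x / M) = ∫⁻ c in Ioo (0 : ℝ) 1, volume {x | c * M < p x} := by
  rw [lintegral_eq_lintegral_meas_lt volume
    (Filter.Eventually.of_forall fun x => div_nonneg (hp.nonneg x) hM.le)
    (hp.measurable.div_const M).aemeasurable]
  have hs : Ioi (0 : ℝ) = Ioo 0 1 ∪ Ici 1 := by
    ext x
    simp only [mem_Ioi, mem_union, mem_Ioo, mem_Ici]
    constructor
    · intro h
      rcases lt_or_ge x 1 with h1 | h1
      · exact Or.inl ⟨h, h1⟩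
      · exact Or.inr h1
    · rintro (h | h)
      · exact h.1
      · linarith
  have hd : Disjoint (Ioo (0 : ℝ) 1) (Ici 1) := by
    rw [Set.disjoint_left]
    intro x hx hx1
    exact absurd hx.2 (not_lt.2 hx1)
  rw [hs, lintegral_union measurableSet_Ici hd]
  have h0 : ∫⁻ t in Ici (1 : ℝ), volume {a | t < p a / M} = 0 := by
    rw [setLIntegral_congr_fun (g := fun _ => 0) measurableSet_Ici]
    · simp
    · intro t ht
      have : {a | t < p a / M} = ∅ := by
        ext a
        simp only [mem_ofPred_eq, mem_empty_iff_false, iff_false, not_lt]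
        exact ((div_le_one hM).2 (hpM a)).trans ht
      simp [this]
  rw [h0, add_zero]
  simp_rw [lt_div_iff₀ hM]

end IsLogConcaveWeight

/-- The Prékopa–Leindler inequality on the line, for weights `F` and `G`. After dividing `F` and `G`
by their suprema, each superlevel set of `H` at a height in `(0, 1)` contains the convex combination
of two nonempty superlevel sets, so Brunn–Minkowski bounds its length from below; integrating over
the height gives the arithmetic mean of the integrals, hence their geometric mean. -/
theorem IsLogConcaveWeight.prekopaLeindler {D₁ D₂ t : ℝ} {F G H : ℝ → ℝ} (ht : 0 < t) (ht1 : t < 1)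
    (hF : IsLogConcaveWeight D₁ F) (hG : IsLogConcaveWeight D₂ G) (hH0 : ∀ x, 0 ≤ H x)
    (hHi : Integrable H)
    (h : ∀ r s, F r ^ (1 - t) * G s ^ t ≤ H ((1 - t) * r + t * s)) :
    (∫ x, F x) ^ (1 - t) * (∫ x, G x) ^ t ≤ ∫ x, H x := by
  have hH00 : 0 ≤ ∫ x, H x := integral_nonneg hH0
  by_cases hF0 : ∀ x, F x = 0
  · simp only [hF0, integral_zero, Real.zero_rpow (by linarith : 1 - t ≠ 0), zero_mul]
    exact hH00
  by_cases hG0 : ∀ x, G x = 0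
  · simp only [hG0, integral_zero, Real.zero_rpow ht.ne', mul_zero]
    exact hH00
  push Not at hF0 hG0
  obtain ⟨x₀, hx₀⟩ := hF0
  obtain ⟨y₀, hy₀⟩ := hG0
  obtain ⟨M, hM, hFM, hM'⟩ := hF.exists_isLUB hx₀
  obtain ⟨N, hN, hGN, hN'⟩ := hG.exists_isLUB hy₀
  set Q := M ^ (1 - t) * N ^ t with hQ
  have hQ0 : 0 < Q := by positivity
  have h1t : 0 ≤ 1 - t := by linarith
  have key : ENNReal.ofReal (1 - t) * (∫⁻ x, ENNReal.ofReal (F x / M))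
      + ENNReal.ofReal t * (∫⁻ x, ENNReal.ofReal (G x / N)) ≤ ∫⁻ x, ENNReal.ofReal (H x / Q) := by
    have hmeas : ∀ K : ℝ → ℝ, ∀ c : ℝ, 0 ≤ c → Measurable fun a : ℝ => volume {x | a * c < K x} := by
      intro K c hc
      refine Antitone.measurable fun a b hab => measure_mono fun x hx => ?_
      exact lt_of_le_of_lt (mul_le_mul_of_nonneg_right hab hc) hx
    rw [hF.lintegral_div_eq hM hFM, hG.lintegral_div_eq hN hGN,
      lintegral_eq_lintegral_meas_lt volume
        (Filter.Eventually.of_forall fun x => div_nonneg (hH0 x) hQ0.le)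
        (hHi.1.aemeasurable.div_const Q),
      ← lintegral_const_mul _ (hmeas F M hM.le), ← lintegral_const_mul _ (hmeas G N hN.le),
      ← lintegral_add_left ((hmeas F M hM.le).const_mul _)]
    refine le_trans (setLIntegral_mono' measurableSet_Ioo fun c hc => ?_)
      (lintegral_mono_set Ioo_subset_Ioi_self)
    have hcM : 0 < c * M := mul_pos hc.1 hM
    have hcN : 0 < c * N := mul_pos hc.1 hN
    refine volume_convex_combination_ge ht ht1 (hF.convex_superlevel hcM)
      (hG.convex_superlevel hcN) (hM' _ (by nlinarith [hc.2])) (hN' _ (by nlinarith [hc.2]))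
      (hF.isBounded_superlevel hcM) (hG.isBounded_superlevel hcN) fun a ha b hb => ?_
    rw [mem_ofPred_eq, lt_div_iff₀ hQ0]
    refine lt_of_lt_of_le ?_ (h a b)
    calc c * Q = (c * M) ^ (1 - t) * (c * N) ^ t := by
          rw [Real.mul_rpow hc.1.le hM.le, Real.mul_rpow hc.1.le hN.le]
          have : c ^ (1 - t) * c ^ t = c := by
            rw [← Real.rpow_add hc.1, sub_add_cancel, Real.rpow_one]
          calc c * Q = (c ^ (1 - t) * c ^ t) * Q := by rw [this]
            _ = _ := by rw [hQ]; ring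
      _ < _ := by
          apply mul_lt_mul'' _ _ (by positivity) (by positivity)
          · exact Real.rpow_lt_rpow hcM.le ha (by linarith)
          · exact Real.rpow_lt_rpow hcN.le hb ht
  rw [← ofReal_integral_eq_lintegral_ofReal (hF.integrable.div_const M)
      (Filter.Eventually.of_forall fun x => div_nonneg (hF.nonneg x) hM.le),
    ← ofReal_integral_eq_lintegral_ofReal (hG.integrable.div_const N)
      (Filter.Eventually.of_forall fun x => div_nonneg (hG.nonneg x) hN.le),
    ← ofReal_integral_eq_lintegral_ofReal (hHi.div_const Q)
      (Filter.Eventually.of_forall fun x => div_nonneg (hH0 x) hQ0.le),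
    ← ENNReal.ofReal_mul h1t, ← ENNReal.ofReal_mul ht.le, integral_div, integral_div,
    integral_div] at key
  have hIF : 0 ≤ ∫ x, F x := integral_nonneg hF.nonneg
  have hIG : 0 ≤ ∫ x, G x := integral_nonneg hG.nonneg
  rw [← ENNReal.ofReal_add (by positivity) (by positivity),
    ENNReal.ofReal_le_ofReal_iff (by positivity)] at key
  have hgm := (Real.geom_mean_le_arith_mean2_weighted h1t ht.le
    (div_nonneg hIF hM.le) (div_nonneg hIG hN.le) (by ring)).trans key
  rw [Real.div_rpow hIF hM.le, Real.div_rpow hIG hN.le, div_mul_div_comm] at hgm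
  exact (div_le_div_iff_of_pos_right hQ0).1 hgm

section marginal

variable {E F : Type*} [NormedAddCommGroup E] [InnerProductSpace ℝ E] [MeasurableSpace E]
  [BorelSpace E] [NormedAddCommGroup F] [InnerProductSpace ℝ F] [MeasurableSpace F] [BorelSpace F]
  {D : ℝ} {p : E → ℝ} {e : E} {J : F →ₗᵢ[ℝ] E}

theorem IsLogConcaveWeight.comp_line (hp : IsLogConcaveWeight D p) (he : ‖e‖ = 1) (v : E) :
    IsLogConcaveWeight D (fun s : ℝ => p (s • e + v)) where
  measurable := hp.measurable.comp (by fun_prop : Continuous fun s : ℝ => s • e + v).measurable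
  nonneg := fun x => hp.nonneg _
  bddAbove := by
    obtain ⟨C, hC⟩ := hp.bddAbove
    exact ⟨C, fun x => hC _⟩
  rpow_mul_rpow_le := by
    intro x y t ht ht1
    convert hp.rpow_mul_rpow_le (x • e + v) (y • e + v) t ht ht1 using 2
    simp only [smul_eq_mul]
    module
  dist_le := fun x y hx hy => by
    have := hp.dist_le _ _ hx hy
    rwa [dist_add_right, dist_eq_norm, ← sub_smul, norm_smul, he, mul_one, ← dist_eq_norm] at this

/-- Integrating a weight along the direction `e` gives a weight on the orthogonal complement,
parametrised by the linear isometry `J`. -/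
theorem IsLogConcaveWeight.marginal [SecondCountableTopology F] (hp : IsLogConcaveWeight D p)
    (he : ‖e‖ = 1) (hJ : ∀ x, inner ℝ e (J x) = 0) :
    IsLogConcaveWeight D (fun x => ∫ s : ℝ, p (s • e + J x)) where
  measurable := by
    have hc : Continuous fun z : F × ℝ => z.2 • e + J z.1 := by fun_prop
    have : StronglyMeasurable (Function.uncurry fun (x : F) (s : ℝ) => p (s • e + J x)) :=
      (hp.measurable.comp hc.measurable).stronglyMeasurable
    exact this.integral_prod_right.measurable
  nonneg := fun x => integral_nonneg fun s => hp.nonneg _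
  bddAbove := by
    obtain ⟨C, hC⟩ := hp.bddAbove
    obtain ⟨z, R, hz⟩ := hp.exists_support_subset_closedBall
    refine ⟨∫ s in Icc (inner ℝ e z - R) (inner ℝ e z + R), C, fun x => ?_⟩
    rw [← setIntegral_eq_integral_of_forall_compl_eq_zero
      (s := Icc (inner ℝ e z - R) (inner ℝ e z + R))]
    · apply setIntegral_mono (hp.comp_line he _).integrable.integrableOn (by simp)
      intro s
      exact hC _
    · intro s hs
      by_contra h
      apply hs
      have h1 := hz h
      rw [Metric.mem_closedBall, dist_eq_norm] at h1
      have h2 : inner ℝ e (s • e + J x - z) = s - inner ℝ e z := by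
        rw [inner_sub_right, inner_add_right, inner_smul_right, hJ, real_inner_self_eq_norm_sq, he]
        ring
      have h3 := abs_real_inner_le_norm e (s • e + J x - z)
      rw [h2, he, one_mul] at h3
      have := abs_le.1 (h3.trans h1)
      constructor <;> linarith [this.1, this.2]
  rpow_mul_rpow_le := by
    intro x y t ht ht1
    refine IsLogConcaveWeight.prekopaLeindler ht ht1 (hp.comp_line he _) (hp.comp_line he _)
      (fun s => hp.nonneg _) (hp.comp_line he _).integrable fun r s => ?_
    convert hp.rpow_mul_rpow_le (r • e + J x) (s • e + J y) t ht ht1 using 2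
    simp only [map_add, map_smul]
    module
  dist_le := by
    intro x y hx hy
    have hex : ∀ z : F, ∫ s : ℝ, p (s • e + J z) ≠ 0 → ∃ s : ℝ, p (s • e + J z) ≠ 0 := by
      intro z hz
      by_contra! h
      simp [h] at hz
    obtain ⟨r, hr⟩ := hex x hx
    obtain ⟨s, hs⟩ := hex y hy
    refine le_trans ?_ (hp.dist_le _ _ hr hs)
    rw [dist_eq_norm, dist_eq_norm]
    have h1 : r • e + J x - (s • e + J y) = (r - s) • e + J (x - y) := by
      rw [map_sub]; module
    have h2 : ‖(r - s) • e + J (x - y)‖ ^ 2 = (r - s) ^ 2 + ‖x - y‖ ^ 2 := by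
      rw [norm_add_sq_real, inner_smul_left, hJ, J.norm_map, norm_smul, he, Real.norm_eq_abs,
        mul_one, sq_abs]
      simp
    rw [h1]
    refine le_of_sq_le_sq ?_ (norm_nonneg _)
    rw [h2]
    nlinarith [sq_nonneg (r - s)]

end marginal

/-! ### Weights that are thin in one direction -/

/-- Orthogonal coordinates adapted to a unit vector `e`: space is the product of the line `ℝ e` and
an isometric copy of `ℝⁿ`, with the product measure. -/
theorem exists_linearIsometry_measurePreserving_split {n : ℕ} {e : Space (n + 1)} (he : ‖e‖ = 1) :
    ∃ J : Space n →ₗᵢ[ℝ] Space (n + 1), (∀ x, inner ℝ e (J x) = 0) ∧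
      MeasurePreserving (fun z : ℝ × Space n => z.1 • e + J z.2) := by
  obtain ⟨b, hb⟩ := Orthonormal.exists_orthonormalBasis_extension_of_card_eq (𝕜 := ℝ)
    (E := Space (n + 1)) (ι := Fin (n + 1)) (by simp) (v := fun _ => e) (s := {0}) (by
      rw [orthonormal_iff_ite]
      rintro ⟨i, rfl⟩ ⟨j, rfl⟩
      simp [he])
  have hb0 : b 0 = e := hb 0 rfl
  set J₀ : Space n →ₗᵢ[ℝ] Space (n + 1) :=
    { toFun := fun x => WithLp.toLp 2 (Fin.cons 0 (WithLp.ofLp x) : Fin (n + 1) → ℝ)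
      map_add' := by
        intro x y
        ext i
        refine Fin.cases ?_ (fun j => ?_) i <;> simp
      map_smul' := by
        intro c x
        ext i
        refine Fin.cases ?_ (fun j => ?_) i <;> simp
      norm_map' := by
        intro x
        simp [EuclideanSpace.norm_eq, Fin.sum_univ_succ] } with hJ₀
  have hJ0 : ∀ x, J₀ x = WithLp.toLp 2 (Fin.cons 0 (WithLp.ofLp x) : Fin (n + 1) → ℝ) := 
    fun _ => rfl
  refine ⟨b.repr.symm.toLinearIsometry.comp J₀, fun x => ?_, ?_⟩
  · rw [← hb0]
    change inner ℝ (b 0) (b.repr.symm (J₀ x)) = 0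
    rw [← b.repr_apply_apply, LinearIsometryEquiv.apply_symm_apply, hJ0]
    simp
  · have h1 : MeasurePreserving (Prod.map id WithLp.ofLp : ℝ × Space n → ℝ × (Fin n → ℝ)) :=
      (MeasurePreserving.id volume).prod (PiLp.volume_preserving_ofLp (Fin n))
    have h2 := (volume_preserving_piFinSuccAbove (fun _ : Fin (n + 1) => ℝ) 0).symm
    have h3 := PiLp.volume_preserving_toLp (Fin (n + 1))
    have h4 := (b.repr.symm.measurePreserving.comp h3).comp (h2.comp h1)
    convert h4 using 1
    ext1 z
    simp only [Function.comp_apply]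
    change z.1 • e + b.repr.symm (J₀ z.2) = _
    rw [← hb0, ← b.repr_symm_single 0, ← map_smul, ← map_add]
    congr 1
    ext i
    rw [hJ0]
    refine Fin.cases ?_ (fun j => ?_) i <;>
      simp [MeasurableEquiv.piFinSuccAbove]

theorem integral_integral_split {E F : Type*} [NormedAddCommGroup E] [InnerProductSpace ℝ E]
    [MeasureSpace E] [NormedAddCommGroup F] [InnerProductSpace ℝ F] [MeasureSpace F]
    [SFinite (volume : Measure F)] {e : E} {J : F →ₗᵢ[ℝ] E}
    (hΨ : MeasurePreserving (fun z : ℝ × F => z.1 • e + J z.2)) {g : E → ℝ} (hg : Integrable g) :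
    ∫ x : F, ∫ s : ℝ, g (s • e + J x) = ∫ y, g y := by
  rw [← hΨ.map_eq, integral_map hΨ.measurable.aemeasurable (by rw [hΨ.map_eq]; exact hg.1)]
  rw [Measure.volume_eq_prod, integral_prod_symm]
  exact (hΨ.integrable_comp hg.1).2 hg

section thin

variable {E F : Type*} [NormedAddCommGroup E] [InnerProductSpace ℝ E] [MeasureSpace E]
  [BorelSpace E] [FiniteDimensional ℝ E] [IsFiniteMeasureOnCompacts (volume : Measure E)]
  [NormedAddCommGroup F] [InnerProductSpace ℝ F] [MeasureSpace F] [SFinite (volume : Measure F)]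
  {D : ℝ} {p : E → ℝ} {e : E} {J : F →ₗᵢ[ℝ] E}

/-- Integrating a slice `g (c e + J ·)` against the marginal of `p` is integrating, against `p`, the
function `g` precomposed with the projection to the hyperplane at height `c`. -/
theorem integral_mul_marginal (hp : IsLogConcaveWeight D p) (he : ‖e‖ = 1)
    (hJ : ∀ x, inner ℝ e (J x) = 0)
    (hΨ : MeasurePreserving (fun z : ℝ × F => z.1 • e + J z.2)) {g : E → ℝ} (hg : Continuous g)
    (c : ℝ) :
    ∫ x : F, g (c • e + J x) * ∫ s : ℝ, p (s • e + J x)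
      = ∫ y, g (y + (c - inner ℝ e y) • e) * p y := by
  rw [← integral_integral_split hΨ (hp.integrable_mul (by fun_prop))]
  congr 1
  ext x
  rw [← integral_const_mul]
  congr 1
  ext s
  have : inner ℝ e (s • e + J x) = s := by
    rw [inner_add_right, inner_smul_right, hJ, real_inner_self_eq_norm_sq, he]
    ring
  rw [this]
  congr 2
  module

theorem abs_integral_mul_sub_le (hp : IsLogConcaveWeight D p) {η c τ : ℝ} (he : ‖e‖ = 1)
    (hthin : ∀ x, p x ≠ 0 → |inner ℝ e x - c| ≤ τ) {g : E → ℝ} (hg : Continuous g)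
    (hgη : ∀ x y, p x ≠ 0 → dist x y ≤ τ → |g x - g y| ≤ η) :
    |(∫ y, g (y + (c - inner ℝ e y) • e) * p y) - ∫ y, g y * p y| ≤ η * ∫ y, p y := by
  rw [← integral_sub (hp.integrable_mul (by fun_prop)) (hp.integrable_mul hg),
    ← integral_const_mul]
  refine (abs_integral_le_integral_abs).trans (integral_mono_of_nonneg
    (Filter.Eventually.of_forall fun y => abs_nonneg _) (hp.integrable.const_mul η)
    (Filter.Eventually.of_forall fun y => ?_))
  simp only
  rw [← sub_mul, abs_mul, abs_of_nonneg (hp.nonneg y)]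
  by_cases hy : p y = 0
  · simp [hy]
  · refine mul_le_mul_of_nonneg_right ?_ (hp.nonneg y)
    rw [abs_sub_comm]
    refine hgη _ _ hy ?_
    rw [dist_eq_norm, sub_add_cancel_left, norm_neg, norm_smul, he, mul_one, Real.norm_eq_abs,
      abs_sub_comm]
    exact hthin y hy

/-- Dimension reduction: if the support of `p` lies within `τ` of a hyperplane `⟪e, x⟫ = c`, and `f`,
`f²` and `|∇f|²` vary by at most `η` over distances up to `τ`, then the Poincaré inequality on `e^⊥`
for the marginal of `p` and the slice of `f` gives that for `p` and `f`, up to a multiple of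
`η ∫ p`. -/
theorem SharpPoincare.integral_sq_mul_le_of_thin [BorelSpace F] [FiniteDimensional ℝ F]
    [IsFiniteMeasureOnCompacts (volume : Measure F)] (hF : SharpPoincare F)
    (hp : IsLogConcaveWeight D p) (he : ‖e‖ = 1) (hJ : ∀ x, inner ℝ e (J x) = 0)
    (hΨ : MeasurePreserving (fun z : ℝ × F => z.1 • e + J z.2)) {f : E → ℝ} (hf : ContDiff ℝ 1 f)
    {k η c τ : ℝ} (hk : 0 ≤ k) (hkD : k * D < Real.pi) (hη0 : 0 ≤ η) (hη1 : η ≤ 1)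
    (hthin : ∀ x, p x ≠ 0 → |inner ℝ e x - c| ≤ τ)
    (h1 : ∀ x y, p x ≠ 0 → dist x y ≤ τ → |f x - f y| ≤ η)
    (h2 : ∀ x y, p x ≠ 0 → dist x y ≤ τ → |f x ^ 2 - f y ^ 2| ≤ η)
    (h3 : ∀ x y, p x ≠ 0 → dist x y ≤ τ → |‖fderiv ℝ f x‖ ^ 2 - ‖fderiv ℝ f y‖ ^ 2| ≤ η)
    (h0 : ∫ x, f x * p x = 0) :
    k ^ 2 * ∫ x, f x ^ 2 * p x
      ≤ (∫ x, ‖fderiv ℝ f x‖ ^ 2 * p x) + (2 * k ^ 2 + 1) * η * ∫ x, p x := by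
  have hfc := hf.continuous
  have hf'c : Continuous fun x => ‖fderiv ℝ f x‖ ^ 2 := by
    have := hf.continuous_fderiv (by simp)
    fun_prop
  have hq := hp.marginal he hJ
  set q : F → ℝ := fun x => ∫ s : ℝ, p (s • e + J x) with hqdef
  have hι : ContDiff ℝ 1 (fun x : F => c • e + J x) := contDiff_const.add J.contDiff
  have key := hF D q hq (fun x => f (c • e + J x)) (hf.comp hι) k hk hkD
  have hder : ∀ x, ‖fderiv ℝ (fun x => f (c • e + J x)) x‖ ^ 2 ≤ ‖fderiv ℝ f (c • e + J x)‖ ^ 2 := by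
    intro x
    have hd : HasFDerivAt (fun x : F => c • e + J x) J.toContinuousLinearMap x :=
      J.toContinuousLinearMap.hasFDerivAt.const_add _
    have hd2 := ((hf.differentiable (by simp) (c • e + J x)).hasFDerivAt.comp x hd)
    have e3 : fderiv ℝ (fun x => f (c • e + J x)) x
      = (fderiv ℝ f (c • e + J x)).comp J.toContinuousLinearMap := hd2.fderiv
    rw [e3]
    refine pow_le_pow_left₀ (norm_nonneg _) ?_ 2
    refine (ContinuousLinearMap.opNorm_comp_le _ _).trans ?_
    exact mul_le_of_le_one_right (norm_nonneg _) J.norm_toContinuousLinearMap_le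
  have hY : ∫ x, ‖fderiv ℝ (fun x => f (c • e + J x)) x‖ ^ 2 * q x
      ≤ ∫ x, ‖fderiv ℝ f (c • e + J x)‖ ^ 2 * q x := by
    have hc1 : Continuous fun x => ‖fderiv ℝ (fun x => f (c • e + J x)) x‖ ^ 2 := by
      have := (hf.comp hι).continuous_fderiv (by simp)
      exact this.norm.pow 2
    refine integral_mono (hq.integrable_mul hc1) (hq.integrable_mul (by fun_prop)) fun x => ?_
    exact mul_le_mul_of_nonneg_right (hder x) (hq.nonneg x)
  have m0 := integral_mul_marginal hp he hJ hΨ (g := fun _ => 1) continuous_const c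
  simp only [one_mul] at m0
  have m1 := abs_integral_mul_sub_le hp he hthin hfc h1
  have m2 := abs_integral_mul_sub_le hp he hthin (g := fun x => f x ^ 2) (hfc.pow 2) h2
  have m3 := abs_integral_mul_sub_le hp he hthin hf'c h3
  rw [← integral_mul_marginal hp he hJ hΨ hfc] at m1
  rw [← integral_mul_marginal hp he hJ hΨ (g := fun x => f x ^ 2) (hfc.pow 2)] at m2
  rw [← integral_mul_marginal hp he hJ hΨ (g := fun x => ‖fderiv ℝ f x‖ ^ 2) hf'c] at m3
  change ∫ x, q x = _ at m0
  change |(∫ x, f (c • e + J x) * q x) - _| ≤ _ at m1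
  change |(∫ x, f (c • e + J x) ^ 2 * q x) - _| ≤ _ at m2
  change |(∫ x, ‖fderiv ℝ f (c • e + J x)‖ ^ 2 * q x) - _| ≤ _ at m3
  rw [m0] at key
  rw [h0, sub_zero] at m1
  set m := ∫ y, p y
  have hm : 0 ≤ m := integral_nonneg hp.nonneg
  rcases hm.eq_or_lt with hm | hm
  · have hae : p =ᵐ[volume] 0 := (integral_eq_zero_iff_of_nonneg hp.nonneg hp.integrable).1 hm.symm
    have hz : ∀ g : E → ℝ, ∫ x, g x * p x = 0 := fun g => integral_eq_zero_of_ae (by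
      filter_upwards [hae] with x hx
      simp [hx])
    rw [hz, hz, ← hm]
    simp
  set X := ∫ x, f (c • e + J x) ^ 2 * q x
  set m₁ := ∫ x, f (c • e + J x) * q x
  set Y := ∫ x, ‖fderiv ℝ f (c • e + J x)‖ ^ 2 * q x
  have a2 := (abs_le.1 m2).1
  have a3 := (abs_le.1 m3).2
  have a1 : m₁ ^ 2 ≤ (η * m) ^ 2 := by
    rw [← sq_abs]
    exact pow_le_pow_left₀ (abs_nonneg _) m1 2
  have b1 : m₁ ^ 2 ≤ m * (η * m) := by nlinarith [mul_nonneg hη0 (sq_nonneg m)]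
  have b2 : k ^ 2 * (m * X) ≤ m * (Y + k ^ 2 * (η * m)) := by
    nlinarith [mul_le_mul_of_nonneg_left hY hm.le, mul_le_mul_of_nonneg_left b1 (sq_nonneg k)]
  have b3 : k ^ 2 * X ≤ Y + k ^ 2 * (η * m) := by
    refine le_of_mul_le_mul_left ?_ hm
    linarith
  nlinarith [mul_le_mul_of_nonneg_left a2 (sq_nonneg k)]

end thin

/-! ### Cutting a weight by half-spaces -/

/-- The unit vector `cos θ e₀ + sin θ e₁` in the plane of the first two coordinates. -/
noncomputable def planarDirection (n : ℕ) (θ : ℝ) : Space (n + 2) :=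
  Real.cos θ • EuclideanSpace.single 0 1 + Real.sin θ • EuclideanSpace.single 1 1

theorem inner_planarDirection {n : ℕ} (θ : ℝ) (x : Space (n + 2)) :
    inner ℝ (planarDirection n θ) x = Real.cos θ * x 0 + Real.sin θ * x 1 := by
  simp [planarDirection, inner_add_left, inner_smul_left, EuclideanSpace.inner_single_left]

theorem norm_planarDirection {n : ℕ} (θ : ℝ) : ‖planarDirection n θ‖ = 1 := by
  have h : ‖planarDirection n θ‖ ^ 2 = 1 := by
    rw [← real_inner_self_eq_norm_sq, inner_planarDirection]
    simp only [planarDirection]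
    simp
    nlinarith [Real.sin_sq_add_cos_sq θ]
  nlinarith [norm_nonneg (planarDirection n θ)]

theorem volume_hyperplane_eq_zero {E : Type*} [NormedAddCommGroup E] [InnerProductSpace ℝ E]
    [FiniteDimensional ℝ E] [MeasurableSpace E] [BorelSpace E] {e : E} (he : ‖e‖ = 1) (c : ℝ) :
    volume {x : E | inner ℝ e x = c} = 0 := by
  have h1 : {x : E | inner ℝ e x = c} =
      (fun x => x + (-(c • e))) ⁻¹' ((ℝ ∙ e)ᗮ : Submodule ℝ E) := by
    ext x
    simp only [mem_ofPred_eq, mem_preimage, SetLike.mem_coe,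
      Submodule.mem_orthogonal_singleton_iff_inner_right]
    rw [inner_add_right, inner_neg_right, inner_smul_right, real_inner_self_eq_norm_sq, he]
    constructor <;> intro h <;> linarith
  rw [h1, measure_preimage_add_right]
  apply Measure.addHaar_submodule
  intro h
  have : e ∈ ((ℝ ∙ e)ᗮ : Submodule ℝ E) := by rw [h]; trivial
  rw [Submodule.mem_orthogonal_singleton_iff_inner_right, real_inner_self_eq_norm_sq, he] at this
  norm_num at this

/-- Through every point of the plane passes a line such that the integral of `g` vanishes over the
half-space above it (hence also over the one below). The integral over the half-space in direction
`θ` depends continuously on `θ` and changes sign when `θ` increases by `π`. -/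
theorem exists_planarDirection_integral_eq_zero {n : ℕ} {g : Space (n + 2) → ℝ}
    (hg : Integrable g) (h0 : ∫ x, g x = 0) (z : ℝ × ℝ) :
    ∃ θ, ∫ x in {x | Real.cos θ * z.1 + Real.sin θ * z.2 < inner ℝ (planarDirection n θ) x}, g x
      = 0 := by
  set H : ℝ → Set (Space (n + 2)) :=
    fun θ => {x | Real.cos θ * z.1 + Real.sin θ * z.2 < inner ℝ (planarDirection n θ) x} with hH
  have hHm : ∀ θ, MeasurableSet (H θ) := fun θ =>
    (isOpen_lt continuous_const (by fun_prop)).measurableSet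
  have hcont : ∀ x, Continuous fun θ => inner ℝ (planarDirection n θ) x := by
    intro x
    simp_rw [inner_planarDirection]
    fun_prop
  have hG : Continuous fun θ => ∫ x, (H θ).indicator g x := by
    rw [continuous_iff_continuousAt]
    intro θ₀
    refine continuousAt_of_dominated (bound := fun x => ‖g x‖)
      (Filter.Eventually.of_forall fun θ => hg.1.indicator (hHm θ))
      (Filter.Eventually.of_forall fun θ => Filter.Eventually.of_forall fun x =>
        norm_indicator_le_norm_self _ _) hg.norm ?_
    have hnull := volume_hyperplane_eq_zero (norm_planarDirection (n := n) θ₀)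
      (Real.cos θ₀ * z.1 + Real.sin θ₀ * z.2)
    have : ∀ᵐ x, x ∉ {x : Space (n + 2) | inner ℝ (planarDirection n θ₀) x
        = Real.cos θ₀ * z.1 + Real.sin θ₀ * z.2} := measure_eq_zero_iff_ae_notMem.1 hnull
    filter_upwards [this] with x hx
    have hcz : Continuous fun θ => Real.cos θ * z.1 + Real.sin θ * z.2 := by fun_prop
    rcases lt_or_gt_of_ne hx with h | h
    · have hev := ((hcont x).continuousAt (x := θ₀)).eventually_lt hcz.continuousAt h
      refine (continuousAt_const (y := (0 : ℝ))).congr ?_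
      filter_upwards [hev] with θ hθ
      rw [indicator_of_notMem]
      exact fun h' => lt_asymm hθ h'
    · have hev := (hcz.continuousAt (x := θ₀)).eventually_lt ((hcont x).continuousAt) h
      refine (continuousAt_const (y := g x)).congr ?_
      filter_upwards [hev] with θ hθ
      rw [indicator_of_mem]
      exact hθ
  have hπ : ∫ x, (H Real.pi).indicator g x = - ∫ x, (H 0).indicator g x := by
    rw [eq_neg_iff_add_eq_zero, ← integral_add (hg.indicator (hHm _)) (hg.indicator (hHm _))]
    refine (integral_congr_ae ?_).trans h0
    have hnull := volume_hyperplane_eq_zero (norm_planarDirection (n := n) 0) z.1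
    filter_upwards [measure_eq_zero_iff_ae_notMem.1 hnull] with x hx
    simp only [inner_planarDirection] at hx
    simp only [indicator_apply, hH, mem_ofPred_eq, inner_planarDirection]
    simp at hx ⊢
    rcases lt_or_gt_of_ne hx with h | h
    · simp [h, h.le]
    · simp [h, h.le]
  have hiv : (0 : ℝ) ∈ uIcc (∫ x, (H 0).indicator g x) (∫ x, (H Real.pi).indicator g x) := by
    rw [hπ, mem_uIcc]
    rcases le_total 0 (∫ x, (H 0).indicator g x) with h | h
    · right; constructor <;> linarith
    · left; constructor <;> linarith
  obtain ⟨θ, _, hθ⟩ := intermediate_value_uIcc (hG.continuousOn (s := uIcc 0 Real.pi)) hiv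
  refine ⟨θ, ?_⟩
  change ∫ x in H θ, g x = 0
  rw [← integral_indicator (hHm θ)]
  exact hθ

/-- The projection of the support of `p` to the plane of the first two coordinates lies in a
half-plane with the point `z` on its boundary. -/
def AvoidsPlanarPoint {n : ℕ} (p : Space (n + 2) → ℝ) (z : ℝ × ℝ) : Prop :=
  ∃ θ, ∀ x, p x ≠ 0 → Real.cos θ * z.1 + Real.sin θ * z.2 ≤ inner ℝ (planarDirection n θ) x

theorem AvoidsPlanarPoint.mono {n : ℕ} {p q : Space (n + 2) → ℝ} {z : ℝ × ℝ}
    (hp : AvoidsPlanarPoint p z) (h : ∀ x, q x ≠ 0 → p x ≠ 0) : AvoidsPlanarPoint q z := by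
  obtain ⟨θ, hθ⟩ := hp
  exact ⟨θ, fun x hx => hθ x (h x hx)⟩

/-- To bound `∫ g p` for weights with `∫ f p = 0`, it is enough to consider weights that avoid
finitely many given points of the plane: cutting at each point splits `p` into two weights with the
same property, and the integral is additive. -/
theorem integral_mul_nonpos_of_avoidsPlanarPoint {n : ℕ} {D : ℝ} {f g : Space (n + 2) → ℝ}
    (hf : Continuous f) (hg : Continuous g) (B : Set (Space (n + 2))) (Z : List (ℝ × ℝ))
    (h : ∀ p, IsLogConcaveWeight D p → Function.support p ⊆ B → ∫ x, f x * p x = 0 →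
      (∀ z ∈ Z, AvoidsPlanarPoint p z) → ∫ x, g x * p x ≤ 0) :
    ∀ p, IsLogConcaveWeight D p → Function.support p ⊆ B → ∫ x, f x * p x = 0 →
      ∫ x, g x * p x ≤ 0 := by
  induction Z with
  | nil => exact fun p hp hB h0 => h p hp hB h0 (by simp)
  | cons z Z ih =>
    refine ih fun p hp hB h0 hZ => ?_
    obtain ⟨θ, hθ⟩ := exists_planarDirection_integral_eq_zero (hp.integrable_mul hf) h0 z
    set H := {x | Real.cos θ * z.1 + Real.sin θ * z.2 < inner ℝ (planarDirection n θ) x} with hH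
    have hHm : MeasurableSet H := (isOpen_lt continuous_const (by fun_prop)).measurableSet
    have hlin : IsLinearMap ℝ fun x : Space (n + 2) => inner ℝ (planarDirection n θ) x :=
      ⟨fun x y => inner_add_right _ _ _, fun c x => inner_smul_right _ _ _⟩
    have hHc : Convex ℝ H := convex_halfSpace_gt hlin _
    have hHcc : Convex ℝ Hᶜ := by
      have : Hᶜ = {x | inner ℝ (planarDirection n θ) x ≤ Real.cos θ * z.1 + Real.sin θ * z.2} := by
        ext x
        simp [hH]
      rw [this]
      exact convex_halfSpace_le hlin _
    have hmul : ∀ (S : Set (Space (n + 2))) (u : Space (n + 2) → ℝ), MeasurableSet S →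
        ∫ x, u x * S.indicator p x = ∫ x in S, u x * p x := by
      intro S u hS
      rw [← integral_indicator hS]
      congr 1
      ext x
      by_cases hx : x ∈ S <;> simp [hx]
    have hsupp : ∀ (S : Set (Space (n + 2))) x, S.indicator p x ≠ 0 → x ∈ S ∧ p x ≠ 0 := by
      intro S x hx
      exact indicator_apply_ne_zero.1 hx
    have hsub : ∀ S : Set (Space (n + 2)), Function.support (S.indicator p) ⊆ B :=
      fun S x hx => hB (hsupp S x hx).2
    have hf0 := integral_add_compl hHm (hp.integrable_mul (μ := volume) hf)
    rw [hθ, zero_add, h0] at hf0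
    have p1 := h _ (hp.indicator hHc hHm) (hsub H) ((hmul H f hHm).trans hθ) (by
      intro w hw
      rcases List.mem_cons.1 hw with rfl | hw
      · exact ⟨θ, fun x hx => le_of_lt (hsupp H x hx).1⟩
      · exact (hZ w hw).mono fun x hx => (hsupp H x hx).2)
    have p2 := h _ (hp.indicator hHcc hHm.compl) (hsub Hᶜ) ((hmul Hᶜ f hHm.compl).trans hf0) (by
      intro w hw
      rcases List.mem_cons.1 hw with rfl | hw
      · -- the complementary half-space has the opposite direction
        refine ⟨θ + Real.pi, fun x hx => ?_⟩
        have := (hsupp Hᶜ x hx).1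
        simp only [hH, mem_compl_iff, mem_ofPred_eq, not_lt, inner_planarDirection] at this
        rw [inner_planarDirection, Real.cos_add_pi, Real.sin_add_pi]
        linarith
      · exact (hZ w hw).mono fun x hx => (hsupp Hᶜ x hx).2)
    rw [hmul _ _ hHm] at p1
    rw [hmul _ _ hHm.compl] at p2
    have := integral_add_compl hHm (hp.integrable_mul (μ := volume) hg)
    linarith

theorem abs_coord_le_norm {n : ℕ} (x : Space n) (i : Fin n) : |x i| ≤ ‖x‖ := by
  simpa using PiLp.norm_apply_le x i

/-! ### Planar convex sets avoiding a fine net are thin -/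

/-- If the triangle spanned by the projections of `x`, `y`, `z` has area bounded below, then the
projection of `S` contains a square of a definite size around its centroid. -/
theorem exists_planar_coords_eq_of_convex {n : ℕ} {S : Set (Space (n + 2))} (hS : Convex ℝ S)
    {R r : ℝ} (hR : 0 < R) (hr : 0 < r) (hSR : S ⊆ Metric.closedBall 0 R) {x y z : Space (n + 2)}
    (hx : x ∈ S) (hy : y ∈ S) (hz : z ∈ S)
    (hd : 24 * R * r ≤ |(y 0 - x 0) * (z 1 - x 1) - (y 1 - x 1) * (z 0 - x 0)|)
    {v₀ v₁ : ℝ} (hv₀ : |v₀| ≤ r) (hv₁ : |v₁| ≤ r) :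
    ∃ w ∈ S, w 0 = (x 0 + y 0 + z 0) / 3 + v₀ ∧ w 1 = (x 1 + y 1 + z 1) / 3 + v₁ := by
  set d := (y 0 - x 0) * (z 1 - x 1) - (y 1 - x 1) * (z 0 - x 0) with hddef
  have hd0 : 0 < |d| := lt_of_lt_of_le (by positivity) hd
  have hdne : d ≠ 0 := abs_pos.1 hd0
  have hco : ∀ u ∈ S, ∀ u' ∈ S, ∀ i, |u i - u' i| ≤ 2 * R := by
    intro u hu u' hu' i
    have h1 := (abs_coord_le_norm u i).trans (mem_closedBall_zero_iff.1 (hSR hu))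
    have h2 := (abs_coord_le_norm u' i).trans (mem_closedBall_zero_iff.1 (hSR hu'))
    rw [abs_le] at *
    constructor <;> linarith [h1.1, h1.2, h2.1, h2.2]
  have hb : ∀ s t : ℝ, |s| ≤ 2 * R → |t| ≤ 2 * R → |(v₀ * s - v₁ * t) / d| ≤ 1 / 6 := by
    intro s t hs ht
    rw [abs_div, div_le_iff₀ hd0]
    have h1 : |v₀ * s| ≤ r * (2 * R) := by
      rw [abs_mul]
      exact mul_le_mul hv₀ hs (abs_nonneg _) hr.le
    have h2 : |v₁ * t| ≤ r * (2 * R) := by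
      rw [abs_mul]
      exact mul_le_mul hv₁ ht (abs_nonneg _) hr.le
    have h3 := abs_sub (v₀ * s) (v₁ * t)
    linarith
  -- Cramer's rule for the barycentric coordinates of the point `centroid + (v₀, v₁)`
  set β' := (v₀ * (z 1 - x 1) - v₁ * (z 0 - x 0)) / d with hβ'
  set γ' := (v₀ * (x 1 - y 1) - v₁ * (x 0 - y 0)) / d with hγ'
  have hβ := abs_le.1 (hb _ _ (hco z hz x hx 1) (hco z hz x hx 0))
  have hγ := abs_le.1 (hb _ _ (hco x hx y hy 1) (hco x hx y hy 0))
  rw [← hβ'] at hβ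
  rw [← hγ'] at hγ
  have e0 : β' * (y 0 - x 0) + γ' * (z 0 - x 0) = v₀ := by
    simp only [hβ', hγ']
    field_simp
    simp only [hddef]
    ring
  have e1 : β' * (y 1 - x 1) + γ' * (z 1 - x 1) = v₁ := by
    simp only [hβ', hγ']
    field_simp
    simp only [hddef]
    ring
  refine ⟨(1 - (1 / 3 + β') - (1 / 3 + γ')) • x + (1 / 3 + β') • y + (1 / 3 + γ') • z, ?_, ?_, ?_⟩
  · have := hS.sum_mem (t := Finset.univ)
      (w := ![1 - (1 / 3 + β') - (1 / 3 + γ'), 1 / 3 + β', 1 / 3 + γ'])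
      (z := ![x, y, z]) ?_ ?_ ?_
    · simpa [Fin.sum_univ_three] using this
    · intro i _
      fin_cases i <;> simp <;> linarith [hβ.1, hβ.2, hγ.1, hγ.2]
    · simp [Fin.sum_univ_three]
      ring
    · intro i _
      fin_cases i <;> simp [hx, hy, hz]
  · simp only [PiLp.add_apply, PiLp.smul_apply, smul_eq_mul]
    rw [← e0]
    ring
  · simp only [PiLp.add_apply, PiLp.smul_apply, smul_eq_mul]
    rw [← e1]
    ring

/-- A planar set that spans only triangles of small area is thin in some direction: in the direction
orthogonal to a pair of points at distance at least `τ`, or in every direction if there is no such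
pair. -/
theorem exists_planarDirection_thin {n : ℕ} {S : Set (Space (n + 2))} {τ : ℝ} (hτ : 0 < τ)
    (h : ∀ x ∈ S, ∀ y ∈ S, ∀ z ∈ S,
      |(y 0 - x 0) * (z 1 - x 1) - (y 1 - x 1) * (z 0 - x 0)| ≤ τ ^ 2) :
    ∃ θ c, ∀ x ∈ S, |inner ℝ (planarDirection n θ) x - c| ≤ τ := by
  rcases S.eq_empty_or_nonempty with rfl | ⟨x₀, hx₀⟩
  · exact ⟨0, 0, by simp⟩
  by_cases hxy : ∃ x ∈ S, ∃ y ∈ S, τ ^ 2 < (y 0 - x 0) ^ 2 + (y 1 - x 1) ^ 2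
  · obtain ⟨x, hx, y, hy, hlt⟩ := hxy
    set w : ℂ := ⟨-(y 1 - x 1), y 0 - x 0⟩ with hw
    have hwn : ‖w‖ ^ 2 = (y 0 - x 0) ^ 2 + (y 1 - x 1) ^ 2 := by
      rw [Complex.sq_norm, Complex.normSq_apply]
      simp only [hw]
      ring
    have hwτ : τ < ‖w‖ := by
      rw [← hwn] at hlt
      exact lt_of_pow_lt_pow_left₀ 2 (norm_nonneg _) hlt
    have hw0 : 0 < ‖w‖ := hτ.trans hwτ
    refine ⟨Complex.arg w, inner ℝ (planarDirection n (Complex.arg w)) x, fun z hz => ?_⟩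
    rw [inner_planarDirection, inner_planarDirection, Complex.sin_arg,
      Complex.cos_arg (norm_pos_iff.1 hw0)]
    have e : w.re / ‖w‖ * z 0 + w.im / ‖w‖ * z 1 - (w.re / ‖w‖ * x 0 + w.im / ‖w‖ * x 1)
      = ((y 0 - x 0) * (z 1 - x 1) - (y 1 - x 1) * (z 0 - x 0)) / ‖w‖ := by
      simp only [hw]
      ring
    rw [e, abs_div, abs_norm, div_le_iff₀ hw0]
    refine (h x hx y hy z hz).trans ?_
    nlinarith
  · push Not at hxy
    refine ⟨0, x₀ 0, fun x hx => ?_⟩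
    have h1 := hxy x₀ hx₀ x hx
    rw [inner_planarDirection, Real.cos_zero, Real.sin_zero, one_mul, zero_mul, add_zero]
    refine abs_le_of_sq_le_sq ?_ hτ.le
    nlinarith [sq_nonneg (x 1 - x₀ 1)]

/-- There is a finite net of the plane such that every weight that is supported in a given ball and
avoids all points of the net is thin in some planar direction. -/
theorem exists_net_forall_thin (n : ℕ) {R τ : ℝ} (hR : 0 < R) (hτ : 0 < τ) :
    ∃ Z : List (ℝ × ℝ), ∀ p : Space (n + 2) → ℝ, Convex ℝ (Function.support p) →
      Function.support p ⊆ Metric.closedBall 0 R → (∀ z ∈ Z, AvoidsPlanarPoint p z) →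
      ∃ θ c, ∀ x, p x ≠ 0 → |inner ℝ (planarDirection n θ) x - c| ≤ τ := by
  -- the size of the square provided by `exists_planar_coords_eq_of_convex`
  set r := τ ^ 2 / (24 * R) with hr
  have hr0 : 0 < r := by positivity
  obtain ⟨T, _, hTf, hT⟩ := (isCompact_closedBall (0 : ℝ × ℝ) R).finite_cover_balls hr0
  refine ⟨hTf.toFinset.toList, fun p hpc hpR hp => exists_planarDirection_thin hτ ?_⟩
  intro x hx y hy z hz
  by_contra! hlt
  have hd : 24 * R * r ≤ |(y 0 - x 0) * (z 1 - x 1) - (y 1 - x 1) * (z 0 - x 0)| := by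
    have : 24 * R * r = τ ^ 2 := by
      simp only [hr]
      field_simp
    linarith
  have hco : ∀ u ∈ Function.support p, ∀ i, |u i| ≤ R := fun u hu i =>
    (abs_coord_le_norm u i).trans (mem_closedBall_zero_iff.1 (hpR hu))
  have hmem : (((x 0 + y 0 + z 0) / 3, (x 1 + y 1 + z 1) / 3) : ℝ × ℝ)
      ∈ Metric.closedBall 0 R := by
    rw [mem_closedBall_zero_iff, Prod.norm_mk, max_le_iff, Real.norm_eq_abs, Real.norm_eq_abs]
    have hc := fun i => And.intro (abs_le.1 (hco x hx i)) (And.intro (abs_le.1 (hco y hy i))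
      (abs_le.1 (hco z hz i)))
    have h0 := hc 0
    have h1 := hc 1
    constructor <;> rw [abs_le] <;> constructor <;> linarith
  obtain ⟨t, htT, ht⟩ := mem_iUnion₂.1 (hT hmem)
  rw [Metric.mem_ball, Prod.dist_eq, max_lt_iff, Real.dist_eq, Real.dist_eq] at ht
  obtain ⟨θ, hθ⟩ := hp t (by simpa using htT)
  set m := max |(x 0 + y 0 + z 0) / 3 - t.1| |(x 1 + y 1 + z 1) / 3 - t.2| with hm
  have hmr : 0 < r - m := by
    have : m < r := max_lt ht.1 ht.2
    linarith
  have hm1 := abs_le.1 (le_max_left |(x 0 + y 0 + z 0) / 3 - t.1| |(x 1 + y 1 + z 1) / 3 - t.2|)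
  have hm2 := abs_le.1 (le_max_right |(x 0 + y 0 + z 0) / 3 - t.1| |(x 1 + y 1 + z 1) / 3 - t.2|)
  rw [← hm] at hm1 hm2
  have hc1 := abs_le.1 (Real.abs_cos_le_one θ)
  have hs1 := abs_le.1 (Real.abs_sin_le_one θ)
  -- a point of the support beyond the line through the net point `t`
  obtain ⟨w, hw, hw0, hw1⟩ := exists_planar_coords_eq_of_convex hpc hR hr0 hpR hx hy hz hd
    (v₀ := t.1 - (r - m) * Real.cos θ - (x 0 + y 0 + z 0) / 3)
    (v₁ := t.2 - (r - m) * Real.sin θ - (x 1 + y 1 + z 1) / 3)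
    (by rw [abs_le]; constructor <;> nlinarith) (by rw [abs_le]; constructor <;> nlinarith)
  have := hθ w hw
  rw [inner_planarDirection, hw0, hw1] at this
  nlinarith [Real.sin_sq_add_cos_sq θ]

/-! ### The sharp Poincaré inequality in all dimensions -/

theorem IsLogConcaveWeight.variance_le_of_forall_integral_eq_zero {E : Type*}
    [NormedAddCommGroup E] [InnerProductSpace ℝ E] [FiniteDimensional ℝ E] [MeasureSpace E]
    [BorelSpace E] [IsFiniteMeasureOnCompacts (volume : Measure E)] {D k : ℝ} {p : E → ℝ}
    (hp : IsLogConcaveWeight D p)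
    (h : ∀ f : E → ℝ, ContDiff ℝ 1 f → ∫ x, f x * p x = 0 →
      k ^ 2 * ∫ x, f x ^ 2 * p x ≤ ∫ x, ‖fderiv ℝ f x‖ ^ 2 * p x)
    {f : E → ℝ} (hf : ContDiff ℝ 1 f) :
    k ^ 2 * ((∫ x, p x) * (∫ x, f x ^ 2 * p x) - (∫ x, f x * p x) ^ 2)
        ≤ (∫ x, p x) * ∫ x, ‖fderiv ℝ f x‖ ^ 2 * p x := by
  have hfc := hf.continuous
  set m := ∫ y, p y with hmdef
  have hm : 0 ≤ m := integral_nonneg hp.nonneg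
  rcases hm.eq_or_lt with hm | hm
  · have hae : p =ᵐ[volume] 0 := (integral_eq_zero_iff_of_nonneg hp.nonneg hp.integrable).1 hm.symm
    have hz : ∀ g : E → ℝ, ∫ x, g x * p x = 0 := fun g => integral_eq_zero_of_ae (by
      filter_upwards [hae] with x hx
      simp [hx])
    simp only [hz]
    simp
  set m₁ := ∫ x, f x * p x with hm₁
  set X := ∫ x, f x ^ 2 * p x with hX
  have i0 : Integrable p := hp.integrable
  have i1 : Integrable fun x => f x * p x := hp.integrable_mul hfc
  have i2 : Integrable fun x => f x ^ 2 * p x := hp.integrable_mul (hfc.pow 2)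
  have e1 : ∫ x, (f x - m₁ / m) * p x = 0 := by
    simp_rw [sub_mul]
    rw [integral_sub i1 (i0.const_mul _), integral_const_mul, ← hm₁, ← hmdef]
    field_simp
    ring
  have e2 : ∫ x, (f x - m₁ / m) ^ 2 * p x = X - m₁ ^ 2 / m := by
    have : ∀ x, (f x - m₁ / m) ^ 2 * p x = f x ^ 2 * p x
      - 2 * (m₁ / m) * (f x * p x) + (m₁ / m) ^ 2 * p x := by intro x; ring
    have i3 : Integrable fun x => f x ^ 2 * p x - 2 * (m₁ / m) * (f x * p x) :=
      i2.sub (i1.const_mul _)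
    simp_rw [this]
    rw [integral_add i3 (i0.const_mul _), integral_sub i2 (i1.const_mul _),
      integral_const_mul, integral_const_mul, ← hm₁, ← hmdef]
    field_simp
    ring
  have h1 := h (fun x => f x - m₁ / m) (hf.sub contDiff_const) e1
  simp only [fderiv_sub_const] at h1
  rw [e2] at h1
  calc k ^ 2 * (m * X - m₁ ^ 2) = m * (k ^ 2 * (X - m₁ ^ 2 / m)) := by field_simp
    _ ≤ _ := by gcongr

theorem exists_forall_dist_le_abs_sub_le {E : Type*} [NormedAddCommGroup E] [NormedSpace ℝ E]
    [FiniteDimensional ℝ E] {g : E → ℝ} (hg : Continuous g) (R : ℝ) {η : ℝ} (hη : 0 < η) :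
    ∃ τ > 0, ∀ x ∈ Metric.closedBall (0 : E) R, ∀ y, dist x y ≤ τ → |g x - g y| ≤ η := by
  have : ProperSpace E := FiniteDimensional.proper ℝ E
  have hu := (isCompact_closedBall (0 : E) (R + 1)).uniformContinuousOn_of_continuous
    hg.continuousOn
  obtain ⟨τ, hτ, h⟩ := Metric.uniformContinuousOn_iff.1 hu η hη
  refine ⟨min 1 (τ / 2), by positivity, fun x hx y hxy => ?_⟩
  rw [mem_closedBall_zero_iff] at hx
  have h1 : dist x y ≤ 1 := hxy.trans (min_le_left _ _)
  have h2 : dist x y < τ := lt_of_le_of_lt (hxy.trans (min_le_right _ _)) (by linarith)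
  refine (h x ?_ y ?_ h2).le
  · rw [mem_closedBall_zero_iff]
    linarith
  · rw [mem_closedBall_zero_iff]
    have h3 := norm_le_norm_add_norm_sub' y x
    rw [← dist_eq_norm, dist_comm] at h3
    linarith

/-- The induction step: a weight is cut into pieces thin enough for the reduction
`SharpPoincare.integral_sq_mul_le_of_thin` to the dimension below, with arbitrarily small error. -/
theorem SharpPoincare.succ {n : ℕ} (hF : SharpPoincare (Space (n + 1))) :
    SharpPoincare (Space (n + 2)) := by
  intro D p hp f₀ hf₀ k hk hkD
  refine hp.variance_le_of_forall_integral_eq_zero (fun f hf h0 => ?_) hf₀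
  have hfc := hf.continuous
  have hf'c : Continuous fun x => ‖fderiv ℝ f x‖ ^ 2 :=
    (hf.continuous_fderiv (by simp)).norm.pow 2
  obtain ⟨R, hR, hpR⟩ : ∃ R, 0 < R ∧ Function.support p ⊆ Metric.closedBall 0 R := by
    obtain ⟨z, R, h⟩ := hp.exists_support_subset_closedBall
    refine ⟨|R| + ‖z‖ + 1, by positivity, fun x hx => ?_⟩
    have h1 := h hx
    rw [Metric.mem_closedBall, dist_eq_norm] at h1
    rw [mem_closedBall_zero_iff]
    have h2 := norm_le_norm_add_norm_sub' x z
    have h3 := le_abs_self R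
    linarith
  have key : ∀ η, 0 < η → η ≤ 1 → k ^ 2 * ∫ x, f x ^ 2 * p x
      ≤ (∫ x, ‖fderiv ℝ f x‖ ^ 2 * p x) + (2 * k ^ 2 + 1) * η * ∫ x, p x := by
    intro η hη hη1
    obtain ⟨τ₁, hτ₁, h1⟩ := exists_forall_dist_le_abs_sub_le hfc R hη
    obtain ⟨τ₂, hτ₂, h2⟩ := exists_forall_dist_le_abs_sub_le (hfc.pow 2) R hη
    obtain ⟨τ₃, hτ₃, h3⟩ := exists_forall_dist_le_abs_sub_le hf'c R hη
    set τ := min τ₁ (min τ₂ τ₃) with hτdef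
    have hτ : 0 < τ := by positivity
    have hle1 : τ ≤ τ₁ := min_le_left _ _
    have hle2 : τ ≤ τ₂ := (min_le_right _ _).trans (min_le_left _ _)
    have hle3 : τ ≤ τ₃ := (min_le_right _ _).trans (min_le_right _ _)
    obtain ⟨Z, hZ⟩ := exists_net_forall_thin n hR hτ
    have hexp : ∀ q, IsLogConcaveWeight D q →
        ∫ x, (k ^ 2 * f x ^ 2 - ‖fderiv ℝ f x‖ ^ 2 - (2 * k ^ 2 + 1) * η) * q x
        = k ^ 2 * (∫ x, f x ^ 2 * q x) - (∫ x, ‖fderiv ℝ f x‖ ^ 2 * q x)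
          - (2 * k ^ 2 + 1) * η * ∫ x, q x := by
      intro q hq
      have i2 : Integrable fun x => f x ^ 2 * q x := hq.integrable_mul (hfc.pow 2)
      have i3 : Integrable fun x => ‖fderiv ℝ f x‖ ^ 2 * q x := hq.integrable_mul hf'c
      have i4 : Integrable fun x => k ^ 2 * (f x ^ 2 * q x) - ‖fderiv ℝ f x‖ ^ 2 * q x :=
        (i2.const_mul _).sub i3
      simp_rw [sub_mul, mul_assoc (k ^ 2)]
      rw [integral_sub i4 (hq.integrable.const_mul _),
        integral_sub (i2.const_mul _) i3, integral_const_mul, integral_const_mul]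
    have := integral_mul_nonpos_of_avoidsPlanarPoint (D := D) hfc
      (g := fun x => k ^ 2 * f x ^ 2 - ‖fderiv ℝ f x‖ ^ 2 - (2 * k ^ 2 + 1) * η) (by fun_prop)
      (Metric.closedBall 0 R) Z (fun q hq hqR hq0 hqZ => ?_) p hp hpR h0
    · rw [hexp p hp] at this
      linarith
    · obtain ⟨θ, c, hthin⟩ := hZ q hq.convex_support hqR hqZ
      obtain ⟨J, hJ, hΨ⟩ := exists_linearIsometry_measurePreserving_split
        (norm_planarDirection (n := n) θ)
      have := hF.integral_sq_mul_le_of_thin hq (norm_planarDirection θ) hJ hΨ hf hk hkD hη.le hη1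
        hthin (fun x y hx hxy => h1 x (hqR hx) y (hxy.trans hle1))
        (fun x y hx hxy => h2 x (hqR hx) y (hxy.trans hle2))
        (fun x y hx hxy => h3 x (hqR hx) y (hxy.trans hle3)) hq0
      rw [hexp q hq]
      linarith
  set m := ∫ x, p x with hm
  have hm0 : 0 ≤ m := integral_nonneg hp.nonneg
  refine le_of_forall_pos_le_add fun ε hε => ?_
  set K := (2 * k ^ 2 + 1) * m with hK
  have hK0 : 0 ≤ K := by positivity
  have h1 := key (min 1 (ε / (K + 1))) (by positivity) (min_le_left _ _)
  have h2 : (2 * k ^ 2 + 1) * min 1 (ε / (K + 1)) * m ≤ ε := by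
    have h3 : (2 * k ^ 2 + 1) * min 1 (ε / (K + 1)) * m = K * min 1 (ε / (K + 1)) := by
      simp only [hK]
      ring
    rw [h3]
    calc K * min 1 (ε / (K + 1)) ≤ K * (ε / (K + 1)) := by
          gcongr
          exact min_le_right _ _
      _ ≤ (K + 1) * (ε / (K + 1)) := by
          gcongr
          linarith
      _ = ε := by field_simp
  linarith

/-- The Payne–Weinberger inequality for `C¹` functions and log-concave weights on `ℝᵈ`. -/
theorem sharpPoincare_space (d : ℕ) : SharpPoincare (Space d) := by
  have h1 : SharpPoincare (Space 1) := sharpPoincare_real.of_linearIsometryEquiv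
    (OrthonormalBasis.singleton (Fin 1) ℝ).repr
  match d with
  | 0 =>
    intro D p hp f₀ hf₀ k hk hkD
    refine hp.variance_le_of_forall_integral_eq_zero (fun f hf h0 => ?_) hf₀
    have hf0 : ∀ x, f x = f 0 := fun x => by rw [Subsingleton.elim x 0]
    have : ∀ x, f x ^ 2 * p x = f 0 * (f x * p x) := fun x => by rw [hf0 x]; ring
    simp_rw [this]
    rw [integral_const_mul, h0, mul_zero, mul_zero]
    exact integral_nonneg fun x => mul_nonneg (sq_nonneg _) (hp.nonneg x)
  | n + 1 =>
    induction n with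
    | zero => exact h1
    | succ n ih => exact ih.succ

/-! ### Mollification -/

section mollification

variable {d : ℕ} {ρ h : Space d → ℝ}

open scoped Convolution in
theorem convolution_lsmul_eq (ρ h : Space d → ℝ) :
    ρ ⋆[ContinuousLinearMap.lsmul ℝ ℝ, volume] h = fun x => ∫ y, ρ (x - y) * h y := by
  ext x
  rw [convolution_eq_swap]
  rfl

theorem contDiff_integral_sub_mul (hρ : ContDiff ℝ 1 ρ) (hρc : HasCompactSupport ρ)
    (hh : Integrable h) : ContDiff ℝ 1 fun x => ∫ y, ρ (x - y) * h y := by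
  rw [← convolution_lsmul_eq]
  exact hρc.contDiff_convolution_left _ hρ hh.locallyIntegrable

theorem fderiv_integral_sub_mul (hρ : ContDiff ℝ 1 ρ) (hρc : HasCompactSupport ρ)
    (hh : Integrable h) (x e : Space d) :
    fderiv ℝ (fun x => ∫ y, ρ (x - y) * h y) x e = ∫ y, fderiv ℝ ρ (x - y) e * h y := by
  rw [← convolution_lsmul_eq, (hρc.hasFDerivAt_convolution_left (ContinuousLinearMap.lsmul ℝ ℝ) hρ
    hh.locallyIntegrable x).fderiv, convolution_eq_swap, ContinuousLinearMap.integral_apply]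
  · rfl
  · exact (HasCompactSupport.convolutionExists_left _ (hρc.fderiv ℝ)
      (hρ.continuous_fderiv (by simp)) hh.locallyIntegrable x).integrable_swap

theorem integrable_sub_mul (hρ : Continuous ρ) (hρc : HasCompactSupport ρ)
    (hh : Integrable h) (x : Space d) : Integrable fun y => ρ (x - y) * h y := by
  obtain ⟨C, hC⟩ := hρc.exists_bound_of_continuous hρ
  exact hh.bdd_mul (by fun_prop : Continuous fun y => ρ (x - y)).aestronglyMeasurable
    (Filter.Eventually.of_forall fun y => hC _)

/-- Jensen's inequality for the mollification of `h`. -/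
theorem sq_integral_sub_mul_le (hρ : Continuous ρ) (hρc : HasCompactSupport ρ)
    (hρ0 : ∀ x, 0 ≤ ρ x) (hρ1 : ∫ x, ρ x = 1) (hh : Integrable h)
    (hh2 : Integrable fun x => h x ^ 2) (x : Space d) :
    (∫ y, ρ (x - y) * h y) ^ 2 ≤ ∫ y, ρ (x - y) * h y ^ 2 := by
  set c := ∫ y, ρ (x - y) * h y with hc
  have i0 : Integrable fun y => ρ (x - y) :=
    (hρ.integrable_of_hasCompactSupport hρc).comp_sub_left x
  have i1 := integrable_sub_mul hρ hρc hh x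
  have i2 := integrable_sub_mul hρ hρc hh2 x
  have h0 : 0 ≤ ∫ y, ρ (x - y) * (h y - c) ^ 2 :=
    integral_nonneg fun y => mul_nonneg (hρ0 _) (sq_nonneg _)
  have e : ∀ y, ρ (x - y) * (h y - c) ^ 2
      = ρ (x - y) * h y ^ 2 - 2 * c * (ρ (x - y) * h y) + c ^ 2 * ρ (x - y) := by
    intro y
    ring
  have i3 : Integrable fun y => ρ (x - y) * h y ^ 2 - 2 * c * (ρ (x - y) * h y) :=
    i2.sub (i1.const_mul _)
  simp_rw [e] at h0
  rw [integral_add i3 (i0.const_mul _), integral_sub i2 (i1.const_mul _), integral_const_mul,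
    integral_const_mul, ← hc, integral_sub_left_eq_self, hρ1] at h0
  linarith

theorem integrable_and_integral_integral_sub_mul (hρ : Continuous ρ) (hρc : HasCompactSupport ρ)
    (hρ1 : ∫ x, ρ x = 1) (hh : Integrable h) :
    Integrable (fun x => ∫ y, ρ (x - y) * h y) ∧ ∫ x, ∫ y, ρ (x - y) * h y = ∫ y, h y := by
  have i0 := hρ.integrable_of_hasCompactSupport (μ := volume) hρc
  have h1 := i0.integrable_convolution (ContinuousLinearMap.lsmul ℝ ℝ) hh
  have h2 := integral_convolution (ContinuousLinearMap.lsmul ℝ ℝ) i0 hh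
  rw [convolution_lsmul_eq] at h1 h2
  refine ⟨h1, h2.trans ?_⟩
  rw [hρ1]
  simp

end mollification

/-- The points whose closed `r`-neighbourhood lies in `K`. -/
def innerParallel {d : ℕ} (K : Set (Space d)) (r : ℝ) : Set (Space d) :=
  {x | Metric.closedBall x r ⊆ K}

section innerParallel

variable {d : ℕ} {K : Set (Space d)} {r : ℝ}

theorem innerParallel_subset (hr : 0 ≤ r) : innerParallel K r ⊆ K := fun _ hx =>
  hx (Metric.mem_closedBall_self hr)

theorem convex_innerParallel (hK : Convex ℝ K) : Convex ℝ (innerParallel K r) := by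
  intro x hx y hy a b ha hb hab z hz
  set v := z - (a • x + b • y) with hv
  have hvn : ‖v‖ ≤ r := by
    rwa [Metric.mem_closedBall, dist_eq_norm] at hz
  have h1 : x + v ∈ K := hx (by simpa [Metric.mem_closedBall, dist_eq_norm] using hvn)
  have h2 : y + v ∈ K := hy (by simpa [Metric.mem_closedBall, dist_eq_norm] using hvn)
  have h3 := hK h1 h2 ha hb hab
  have h4 : a • (x + v) + b • (y + v) = z := by
    have : a • (x + v) + b • (y + v) = a • x + b • y + (a + b) • v := by module
    rw [this, hab, hv]
    simp
  rwa [h4] at h3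

open scoped Pointwise in
theorem isOpen_innerParallel (hK : IsOpen K) : IsOpen (innerParallel K r) := by
  have h : innerParallel K r = (Kᶜ + Metric.closedBall 0 r)ᶜ := by
    ext x
    simp only [innerParallel, mem_ofPred_eq, mem_compl_iff, Set.mem_add, not_exists, not_and]
    constructor
    · rintro h y hy z hz rfl
      refine hy (h ?_)
      rw [mem_closedBall_zero_iff] at hz
      rw [Metric.mem_closedBall, dist_eq_norm]
      simpa using hz
    · intro h y hy
      by_contra hyK
      refine h y hyK (x - y) ?_ (by abel)
      rw [mem_closedBall_zero_iff, ← dist_eq_norm, dist_comm]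
      exact hy
  rw [h, isOpen_compl_iff]
  exact hK.isClosed_compl.add_right_of_isCompact (isCompact_closedBall 0 r)

theorem eventually_mem_innerParallel (hK : IsOpen K) {x : Space d} (hx : x ∈ K) {ι : Type*}
    {l : Filter ι} {s : ι → ℝ} (hs : Filter.Tendsto s l (nhds 0)) :
    ∀ᶠ i in l, x ∈ innerParallel K (s i) := by
  obtain ⟨ε, hε, h⟩ := Metric.isOpen_iff.1 hK x hx
  filter_upwards [hs.eventually_lt_const hε] with i hi
  exact (Metric.closedBall_subset_ball hi).trans h

theorem isLogConcaveWeight_indicator_one {S : Set (Space d)} {D : ℝ} (hS : Convex ℝ S)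
    (hSm : MeasurableSet S) (hD : ∀ x ∈ S, ∀ y ∈ S, dist x y ≤ D) :
    IsLogConcaveWeight D (S.indicator fun _ => (1 : ℝ)) where
  measurable := measurable_const.indicator hSm
  nonneg := fun x => indicator_nonneg (fun _ _ => zero_le_one) x
  bddAbove := ⟨1, fun x => indicator_le_self' (fun _ _ => zero_le_one) x⟩
  rpow_mul_rpow_le := by
    intro x y t ht ht1
    have h0 : 0 ≤ S.indicator (fun _ => (1 : ℝ)) ((1 - t) • x + t • y) :=
      indicator_nonneg (fun _ _ => zero_le_one) _
    by_cases hx : x ∈ S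
    · by_cases hy : y ∈ S
      · rw [indicator_of_mem hx, indicator_of_mem hy,
          indicator_of_mem (hS hx hy (by linarith) ht.le (by ring))]
        simp
      · rwa [indicator_of_notMem hy, Real.zero_rpow ht.ne', mul_zero]
    · rwa [indicator_of_notMem hx, Real.zero_rpow (by linarith), zero_mul]
  dist_le := fun x y hx hy =>
    hD x (indicator_apply_ne_zero.1 hx).1 y (indicator_apply_ne_zero.1 hy).1

end innerParallel

/-- The variance of `u` as a double integral, which makes it accessible to Fatou's lemma. -/
theorem lintegral_prod_sq_sub {X : Type*} [MeasurableSpace X] {μ : Measure X} [IsFiniteMeasure μ]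
    {u : X → ℝ} (hu : MemLp u 2 μ) :
    ∫⁻ z, ENNReal.ofReal ((u z.1 - u z.2) ^ 2) ∂(μ.prod μ)
      = ENNReal.ofReal (2 * (μ.real univ * (∫ x, u x ^ 2 ∂μ) - (∫ x, u x ∂μ) ^ 2)) := by
  have i1 : Integrable u μ := hu.integrable (by norm_num)
  have i2 : Integrable (fun x => u x ^ 2) μ := hu.integrable_sq
  have j1 : Integrable (fun z : X × X => u z.1 ^ 2 * 1) (μ.prod μ) :=
    i2.mul_prod (integrable_const (1 : ℝ))
  have j2 : Integrable (fun z : X × X => 1 * u z.2 ^ 2) (μ.prod μ) :=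
    (integrable_const (1 : ℝ)).mul_prod i2
  have j3 : Integrable (fun z : X × X => u z.1 * u z.2) (μ.prod μ) := i1.mul_prod i1
  have e : ∀ z : X × X, (u z.1 - u z.2) ^ 2
      = u z.1 ^ 2 * 1 + 1 * u z.2 ^ 2 - 2 * (u z.1 * u z.2) := by
    intro z
    ring
  have j4 : Integrable (fun z : X × X => u z.1 ^ 2 * 1 + 1 * u z.2 ^ 2) (μ.prod μ) := j1.add j2
  have j5 : Integrable (fun z : X × X => u z.1 ^ 2 * 1 + 1 * u z.2 ^ 2 - 2 * (u z.1 * u z.2))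
      (μ.prod μ) := j4.sub (j3.const_mul 2)
  simp_rw [e]
  rw [← ofReal_integral_eq_lintegral_ofReal j5
    (Filter.Eventually.of_forall fun z => by
      simp only [Pi.zero_apply]
      rw [← e]
      positivity)]
  congr 1
  rw [integral_sub j4 (j3.const_mul 2), integral_add j1 j2,
    integral_prod_mul (fun x => u x ^ 2) (fun _ => (1 : ℝ)),
    integral_prod_mul (fun _ => (1 : ℝ)) (fun x => u x ^ 2), integral_const_mul,
    integral_prod_mul]
  simp
  ring

/-! ### The sharp Poincaré inequality for weakly differentiable functions -/

section weak

variable {d : ℕ} {Ω K : Set (Space d)} {w : L2 Ω} {G : L2Vec Ω}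

/-- The definition of the weak gradient, tested with a translate of the mollifier. -/
theorem IsWeakGradient.integral_fderiv_sub_mul (hwG : IsWeakGradient Ω w G) (hΩ : MeasurableSet Ω)
    (hKΩ : K ⊆ Ω) (hKm : MeasurableSet K) {ρ : Space d → ℝ} {r : ℝ} (hρ : ContDiff ℝ ∞ ρ)
    (hρr : tsupport ρ ⊆ Metric.closedBall 0 r) {x : Space d}
    (hx : x ∈ innerParallel K r) (e : Space d) :
    ∫ y, fderiv ℝ ρ (x - y) e * K.indicator w y
      = ∫ y in K, inner ℝ (G y) e * ρ (x - y) := by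
  have hsuppx : ∀ y, x - y ∈ tsupport ρ → y ∈ Metric.closedBall x r := by
    intro y hy
    have := hρr hy
    rw [mem_closedBall_zero_iff] at this
    rwa [Metric.mem_closedBall, dist_comm, dist_eq_norm]
  have hts : tsupport (fun y => ρ (x - y)) ⊆ Metric.closedBall x r := by
    refine closure_minimal (fun y hy => hsuppx y (subset_tsupport ρ hy)) Metric.isClosed_closedBall
  have htest : IsTest Ω fun y => ρ (x - y) :=
    ⟨by fun_prop, HasCompactSupport.of_support_subset_isCompact (isCompact_closedBall x r)
      ((subset_tsupport _).trans hts), hts.trans (hx.trans hKΩ)⟩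
  have hder : ∀ y, fderiv ℝ (fun y => ρ (x - y)) y e = - fderiv ℝ ρ (x - y) e := by
    intro y
    have h1 := ((hρ.differentiable (by simp) (x - y)).hasFDerivAt.comp y
      ((hasFDerivAt_id y).const_sub x)).fderiv
    change fderiv ℝ (ρ ∘ fun y => x - y) y e = _
    have h2 : fderiv ℝ (ρ ∘ fun y => x - y) y = _ := h1
    rw [h2]
    simp
  have h := hwG _ htest e
  have hzero : ∀ y ∈ Ω \ K, x - y ∉ tsupport ρ := fun y hy h => hy.2 (hx (hsuppx y h))
  simp_rw [hder] at h
  rw [setIntegral_eq_of_subset_of_forall_sdiff_eq_zero hΩ hKΩ,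
    setIntegral_eq_of_subset_of_forall_sdiff_eq_zero hΩ hKΩ] at h
  · have e1 : ∀ y, fderiv ℝ ρ (x - y) e * K.indicator w y
        = K.indicator (fun y => fderiv ℝ ρ (x - y) e * w y) y := by
      intro y
      by_cases hy : y ∈ K <;> simp [hy]
    simp_rw [e1]
    rw [integral_indicator hKm, ← neg_inj, ← h, ← integral_neg]
    congr 1
    ext y
    ring
  · intro y hy
    rw [image_eq_zero_of_notMem_tsupport (hzero y hy), mul_zero]
  · intro y hy
    have : fderiv ℝ ρ (x - y) = 0 := by
      by_contra h'
      exact hzero y hy (support_fderiv_subset ℝ h')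
    simp [this]

theorem integrable_indicator_coeFn (hKΩ : K ⊆ Ω) (hKm : MeasurableSet K)
    (hKv : volume K ≠ ⊤) (w : L2 Ω) : Integrable (K.indicator w) := by
  have : IsFiniteMeasure (volume.restrict K) := ⟨by simpa using hKv.lt_top⟩
  rw [integrable_indicator_iff hKm]
  exact ((Lp.memLp w).mono_measure (Measure.restrict_mono hKΩ le_rfl)).integrable (by norm_num)

theorem memLp_restrict (hKΩ : K ⊆ Ω) (w : L2 Ω) : MemLp w 2 (volume.restrict K) :=
  (Lp.memLp w).mono_measure (Measure.restrict_mono hKΩ le_rfl)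

theorem memLp_norm_restrict (hKΩ : K ⊆ Ω) (G : L2Vec Ω) :
    MemLp (fun x => ‖G x‖) 2 (volume.restrict K) :=
  ((Lp.memLp G).mono_measure (Measure.restrict_mono hKΩ le_rfl)).norm

theorem IsWeakGradient.norm_fderiv_mollification_le (hwG : IsWeakGradient Ω w G)
    (hΩ : MeasurableSet Ω) (hKΩ : K ⊆ Ω) (hKm : MeasurableSet K) (hKv : volume K ≠ ⊤)
    {ρ : Space d → ℝ} {r : ℝ} (hρ : ContDiff ℝ ∞ ρ) (hρc : HasCompactSupport ρ)
    (hρ0 : ∀ x, 0 ≤ ρ x) (hρr : tsupport ρ ⊆ Metric.closedBall 0 r) {x : Space d}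
    (hx : x ∈ innerParallel K r) :
    ‖fderiv ℝ (fun x => ∫ y, ρ (x - y) * K.indicator w y) x‖
      ≤ ∫ y, ρ (x - y) * K.indicator (fun y => ‖G y‖) y := by
  have : IsFiniteMeasure (volume.restrict K) := ⟨by simpa using hKv.lt_top⟩
  have hρ1 : ContDiff ℝ 1 ρ := hρ.of_le (by simp)
  have iG : Integrable (K.indicator fun y => ‖G y‖) := by
    rw [integrable_indicator_iff hKm]
    exact (memLp_norm_restrict hKΩ G).integrable (by norm_num)
  have e1 : ∀ y, ρ (x - y) * K.indicator (fun y => ‖G y‖) y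
      = K.indicator (fun y => ρ (x - y) * ‖G y‖) y := by
    intro y
    by_cases hy : y ∈ K <;> simp [hy]
  have i1 := integrable_sub_mul hρ.continuous hρc iG x
  simp_rw [e1] at i1 ⊢
  rw [integrable_indicator_iff hKm] at i1
  rw [integral_indicator hKm]
  refine ContinuousLinearMap.opNorm_le_bound _
    (integral_nonneg fun y => mul_nonneg (hρ0 _) (norm_nonneg _)) fun e => ?_
  rw [fderiv_integral_sub_mul hρ1 hρc (integrable_indicator_coeFn hKΩ hKm hKv w),
    hwG.integral_fderiv_sub_mul hΩ hKΩ hKm hρ hρr hx, ← integral_mul_const]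
  refine norm_integral_le_of_norm_le (i1.mul_const _) (Filter.Eventually.of_forall fun y => ?_)
  rw [norm_mul, Real.norm_of_nonneg (hρ0 _)]
  have := norm_inner_le_norm (𝕜 := ℝ) (G y) e
  calc ‖inner ℝ (G y) e‖ * ρ (x - y) ≤ (‖G y‖ * ‖e‖) * ρ (x - y) :=
        mul_le_mul_of_nonneg_right this (hρ0 _)
    _ = _ := by ring

/-- The Poincaré inequality for the mollification at scale `r`, on the inner parallel set at
distance `r`. -/
theorem IsWeakGradient.variance_mollification_le (hwG : IsWeakGradient Ω w G)
    (hΩ : MeasurableSet Ω) (hKΩ : K ⊆ Ω) (hK : IsOpen K) (hKc : Convex ℝ K) (hKv : volume K ≠ ⊤)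
    {D k r : ℝ} (hD : ∀ x ∈ K, ∀ y ∈ K, dist x y ≤ D) (hk : 0 ≤ k) (hkD : k * D < Real.pi)
    (hr : 0 ≤ r) {ρ : Space d → ℝ} (hρ : ContDiff ℝ ∞ ρ) (hρc : HasCompactSupport ρ)
    (hρ0 : ∀ x, 0 ≤ ρ x) (hρ1 : ∫ x, ρ x = 1) (hρr : tsupport ρ ⊆ Metric.closedBall 0 r)
    {u : Space d → ℝ} (hu : u = fun x => ∫ y, ρ (x - y) * K.indicator w y) :
    k ^ 2 * (volume.real (innerParallel K r) * (∫ x in innerParallel K r, u x ^ 2)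
        - (∫ x in innerParallel K r, u x) ^ 2)
      ≤ volume.real K * ∫ x in K, ‖G x‖ ^ 2 := by
  have : IsFiniteMeasure (volume.restrict K) := ⟨by simpa using hKv.lt_top⟩
  have hKm := hK.measurableSet
  have hSK : innerParallel K r ⊆ K := innerParallel_subset hr
  have hSm : MeasurableSet (innerParallel K r) := (isOpen_innerParallel hK).measurableSet
  have hp : IsLogConcaveWeight D ((innerParallel K r).indicator fun _ => (1 : ℝ)) :=
    isLogConcaveWeight_indicator_one (convex_innerParallel hKc) hSm
      fun x hx y hy => hD x (hSK hx) y (hSK hy)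
  have huC : ContDiff ℝ 1 u := by
    rw [hu]
    exact contDiff_integral_sub_mul (hρ.of_le (by simp)) hρc
      (integrable_indicator_coeFn hKΩ hKm hKv w)
  have h := sharpPoincare_space d D _ hp u huC k hk hkD
  have e : ∀ g : Space d → ℝ, ∫ x, g x * (innerParallel K r).indicator (fun _ => (1 : ℝ)) x
      = ∫ x in innerParallel K r, g x := by
    intro g
    rw [← integral_indicator hSm]
    congr 1
    ext x
    by_cases hx : x ∈ innerParallel K r <;> simp [hx]
  have e0 : ∫ x, (innerParallel K r).indicator (fun _ => (1 : ℝ)) x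
      = volume.real (innerParallel K r) := by
    rw [integral_indicator hSm]
    simp
  rw [e, e, e, e0] at h
  refine h.trans ?_
  have hvol : volume.real (innerParallel K r) ≤ volume.real K := measureReal_mono hSK hKv
  refine mul_le_mul hvol ?_ (integral_nonneg fun x => sq_nonneg _) measureReal_nonneg
  have iG : Integrable (K.indicator fun y => ‖G y‖) := by
    rw [integrable_indicator_iff hKm]
    exact (memLp_norm_restrict hKΩ G).integrable (by norm_num)
  have iG2' : Integrable (K.indicator fun y => ‖G y‖ ^ 2) := by
    rw [integrable_indicator_iff hKm]
    exact (memLp_norm_restrict hKΩ G).integrable_sq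
  have eG : ∀ y, K.indicator (fun y => ‖G y‖) y ^ 2 = K.indicator (fun y => ‖G y‖ ^ 2) y := by
    intro y
    by_cases hy : y ∈ K <;> simp [hy]
  have iG2 : Integrable fun y => K.indicator (fun y => ‖G y‖) y ^ 2 := by
    simp_rw [eG]
    exact iG2'
  obtain ⟨j1, j2⟩ := integrable_and_integral_integral_sub_mul hρ.continuous hρc hρ1 iG2
  simp_rw [eG] at j2
  rw [integral_indicator hKm] at j2
  rw [← j2]
  simp_rw [← eG]
  have hnn : ∀ x, 0 ≤ ∫ y, ρ (x - y) * K.indicator (fun y => ‖G y‖) y ^ 2 := fun x =>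
    integral_nonneg fun y => mul_nonneg (hρ0 _) (sq_nonneg _)
  refine le_trans (setIntegral_mono_on_ae₀ ?_ j1.integrableOn hSm.nullMeasurableSet
    (Filter.Eventually.of_forall fun x hx => ?_)) (setIntegral_le_integral j1
      (Filter.Eventually.of_forall hnn))
  · have hc : Continuous fun x => ‖fderiv ℝ u x‖ ^ 2 :=
      (huC.continuous_fderiv (by simp)).norm.pow 2
    have := hp.integrable_mul (μ := volume) hc
    rw [← integrable_indicator_iff hSm]
    refine this.congr (Filter.Eventually.of_forall fun x => ?_)
    by_cases hx : x ∈ innerParallel K r <;> simp [hx]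
  · refine le_trans ?_ (sq_integral_sub_mul_le hρ.continuous hρc hρ0 hρ1 iG iG2 x)
    refine pow_le_pow_left₀ (norm_nonneg _) ?_ 2
    rw [hu]
    exact hwG.norm_fderiv_mollification_le hΩ hKΩ hKm hKv hρ hρc hρ0 hρr hx

/-- The Payne–Weinberger inequality on a bounded open convex set `K` of diameter at most `D`, for a
function with a weak gradient in `L²`. The inequality for the mollifications passes to the limit
almost everywhere by Fatou's lemma. -/
theorem IsWeakGradient.variance_le (hwG : IsWeakGradient Ω w G)
    (hΩ : MeasurableSet Ω) (hKΩ : K ⊆ Ω) (hK : IsOpen K) (hKc : Convex ℝ K) (hKv : volume K ≠ ⊤)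
    {D k : ℝ} (hD : ∀ x ∈ K, ∀ y ∈ K, dist x y ≤ D) (hk : 0 ≤ k) (hkD : k * D < Real.pi) :
    k ^ 2 * (volume.real K * (∫ x in K, w x ^ 2) - (∫ x in K, w x) ^ 2)
      ≤ volume.real K * ∫ x in K, ‖G x‖ ^ 2 := by
  have : IsFiniteMeasure (volume.restrict K) := ⟨by simpa using hKv.lt_top⟩
  have hKm := hK.measurableSet
  set Y := volume.real K * ∫ x in K, ‖G x‖ ^ 2 with hY
  have hY0 : 0 ≤ Y := mul_nonneg measureReal_nonneg (integral_nonneg fun x => sq_nonneg _)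
  rcases hk.eq_or_lt with rfl | hk
  · simpa using hY0
  set s : ℕ → ℝ := fun n => 1 / ((n : ℝ) + 1) with hs
  have hs0 : ∀ n, 0 < s n := fun n => by positivity
  have hslim : Filter.Tendsto s Filter.atTop (nhds 0) := tendsto_one_div_add_atTop_nhds_zero_nat
  set φ : ℕ → ContDiffBump (0 : Space d) := fun n =>
    { rIn := s n / 2, rOut := s n, rIn_pos := by have := hs0 n; positivity,
      rIn_lt_rOut := by have := hs0 n; linarith } with hφ
  set u : ℕ → Space d → ℝ := fun n x => ∫ y, (φ n).normed volume (x - y) * K.indicator w y with hu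
  have iw := integrable_indicator_coeFn hKΩ hKm hKv w
  have hcont : ∀ n, Continuous (u n) := fun n =>
    (contDiff_integral_sub_mul (φ n).contDiff_normed (φ n).hasCompactSupport_normed iw).continuous
  have hbdd : ∀ n, ∃ C, ∀ x, ‖u n x‖ ≤ C := by
    intro n
    obtain ⟨C, hC⟩ := ((φ n).hasCompactSupport_normed (μ := volume)).exists_bound_of_continuous
      (φ n).continuous_normed
    refine ⟨∫ y, C * ‖K.indicator w y‖, fun x => norm_integral_le_of_norm_le (iw.norm.const_mul C)
      (Filter.Eventually.of_forall fun y => ?_)⟩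
    rw [norm_mul]
    exact mul_le_mul_of_nonneg_right (hC _) (norm_nonneg _)
  have hvar : ∀ n, volume.real (innerParallel K (s n)) * (∫ x in innerParallel K (s n), u n x ^ 2)
        - (∫ x in innerParallel K (s n), u n x) ^ 2 ≤ Y / k ^ 2 := by
    intro n
    rw [le_div_iff₀' (by positivity)]
    exact hwG.variance_mollification_le hΩ hKΩ hK hKc hKv hD hk.le hkD (hs0 n).le
      (φ n).contDiff_normed (φ n).hasCompactSupport_normed (φ n).nonneg_normed
      (φ n).integral_normed (φ n).tsupport_normed_eq.subset rfl
  have hae : ∀ᵐ x ∂(volume.restrict K),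
      Filter.Tendsto (fun n => u n x) Filter.atTop (nhds (w x)) := by
    have h := ContDiffBump.ae_convolution_tendsto_right_of_locallyIntegrable (φ := φ)
      (l := Filter.atTop) (K := 2) (μ := volume) hslim
      (Filter.Eventually.of_forall fun n => by simp only [hφ]; linarith) iw.locallyIntegrable
    rw [ae_restrict_iff' hKm]
    filter_upwards [h] with x hx hxK
    simp_rw [convolution_lsmul_eq] at hx
    rwa [indicator_of_mem hxK] at hx
  set μ := volume.restrict K with hμ
  set Φ : ℕ → Space d × Space d → ENNReal := fun n =>
    (innerParallel K (s n) ×ˢ innerParallel K (s n)).indicator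
      fun z => ENNReal.ofReal ((u n z.1 - u n z.2) ^ 2) with hΦ
  have hSm : ∀ n, MeasurableSet (innerParallel K (s n)) := fun n =>
    (isOpen_innerParallel hK).measurableSet
  have hΦm : ∀ n, Measurable (Φ n) := fun n =>
    Measurable.indicator (by have := hcont n; fun_prop) ((hSm n).prod (hSm n))
  have hfatou := lintegral_liminf_le (u := Filter.atTop) (μ := μ.prod μ) hΦm
  have hlow : ∫⁻ z, ENNReal.ofReal ((w z.1 - w z.2) ^ 2) ∂(μ.prod μ)
      ≤ ∫⁻ z, Filter.liminf (fun n => Φ n z) Filter.atTop ∂(μ.prod μ) := by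
    refine lintegral_mono_ae ?_
    have h1 : ∀ᵐ z ∂(μ.prod μ), z.1 ∈ K ∧
        Filter.Tendsto (fun n => u n z.1) Filter.atTop (nhds (w z.1)) :=
      Measure.quasiMeasurePreserving_fst.ae ((ae_restrict_mem hKm).and hae)
    have h2 : ∀ᵐ z ∂(μ.prod μ), z.2 ∈ K ∧
        Filter.Tendsto (fun n => u n z.2) Filter.atTop (nhds (w z.2)) :=
      Measure.quasiMeasurePreserving_snd.ae ((ae_restrict_mem hKm).and hae)
    filter_upwards [h1, h2] with z hz1 hz2
    have hlim : Filter.Tendsto (fun n => Φ n z) Filter.atTop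
        (nhds (ENNReal.ofReal ((w z.1 - w z.2) ^ 2))) := by
      refine (ENNReal.tendsto_ofReal ((hz1.2.sub hz2.2).pow 2)).congr' ?_
      filter_upwards [eventually_mem_innerParallel hK hz1.1 hslim,
        eventually_mem_innerParallel hK hz2.1 hslim] with n hn1 hn2
      simp only [hΦ]
      rw [indicator_of_mem (mk_mem_prod hn1 hn2)]
    exact hlim.liminf_eq.ge
  have hup : ∀ n, ∫⁻ z, Φ n z ∂(μ.prod μ) ≤ ENNReal.ofReal (2 * (Y / k ^ 2)) := by
    intro n
    have hSK : innerParallel K (s n) ⊆ K := innerParallel_subset (hs0 n).le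
    have : IsFiniteMeasure (volume.restrict (innerParallel K (s n))) :=
      ⟨by simpa using (measure_mono hSK).trans_lt hKv.lt_top⟩
    simp only [hΦ]
    rw [lintegral_indicator ((hSm n).prod (hSm n)), hμ, ← Measure.prod_restrict,
      Measure.restrict_restrict_of_subset hSK, lintegral_prod_sq_sub]
    · refine ENNReal.ofReal_le_ofReal ?_
      have := hvar n
      simp only [measureReal_restrict_apply_univ]
      linarith
    · obtain ⟨C, hC⟩ := hbdd n
      exact MemLp.of_bound (hcont n).aestronglyMeasurable C (Filter.Eventually.of_forall hC)
  have hfin := (hlow.trans hfatou).trans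
    (Filter.liminf_le_of_frequently_le' (Filter.Frequently.of_forall hup))
  rw [lintegral_prod_sq_sub (memLp_restrict hKΩ w), ENNReal.ofReal_le_ofReal_iff (by positivity)]
    at hfin
  rw [measureReal_restrict_apply_univ] at hfin
  rw [← le_div_iff₀' (by positivity)]
  linarith

end weak

/-! ### Local Poincaré inequalities -/

/-- Letting `k` increase to `π / D` (to infinity if `D = 0`). -/
theorem le_div_pi_sq_mul_of_forall {A Y D : ℝ} (hD : 0 ≤ D) (hY : 0 ≤ Y)
    (h : ∀ k : ℝ, 0 ≤ k → k * D < Real.pi → k ^ 2 * A ≤ Y) : A ≤ (D / Real.pi) ^ 2 * Y := by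
  have hpi := Real.pi_pos
  by_contra! hlt
  have hA : 0 < A := lt_of_le_of_lt (by positivity) hlt
  have h0 : (D * √(Y / A)) < Real.pi := by
    refine lt_of_pow_lt_pow_left₀ 2 hpi.le ?_
    rw [mul_pow, Real.sq_sqrt (by positivity), ← mul_div_assoc, div_lt_iff₀ hA]
    rw [div_pow, div_mul_eq_mul_div, div_lt_iff₀ (by positivity)] at hlt
    linarith
  obtain ⟨ε, hε, hε'⟩ : ∃ ε > 0, (√(Y / A) + ε) * D < Real.pi := by
    refine ⟨(Real.pi - D * √(Y / A)) / (D + 1), div_pos (by linarith) (by linarith), ?_⟩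
    have h1 : (Real.pi - D * √(Y / A)) / (D + 1) * D < Real.pi - D * √(Y / A) := by
      rw [div_mul_eq_mul_div, div_lt_iff₀ (by linarith)]
      nlinarith
    nlinarith
  have h1 := h (√(Y / A) + ε) (by positivity) hε'
  have h2 : √(Y / A) ^ 2 * A = Y := by
    rw [Real.sq_sqrt (by positivity)]
    field_simp
  nlinarith [Real.sqrt_nonneg (Y / A), mul_pos hε hA, mul_pos (mul_pos hε hε) hA,
    mul_nonneg (mul_nonneg (Real.sqrt_nonneg (Y / A)) hε.le) hA.le]

section finite

variable {X : Type*} [MeasurableSpace X] {μ : Measure X} [IsFiniteMeasure μ] {u : X → ℝ}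

theorem integral_sub_const_sq (hu : MemLp u 2 μ) (c : ℝ) :
    ∫ x, (u x - c) ^ 2 ∂μ = (∫ x, u x ^ 2 ∂μ) - 2 * c * (∫ x, u x ∂μ) + c ^ 2 * μ.real univ := by
  have i1 : Integrable u μ := hu.integrable (by norm_num)
  have i2 : Integrable (fun x => u x ^ 2) μ := hu.integrable_sq
  have e : ∀ x, (u x - c) ^ 2 = u x ^ 2 - 2 * c * u x + c ^ 2 := by
    intro x
    ring
  have i3 : Integrable (fun x => u x ^ 2 - 2 * c * u x) μ := i2.sub (i1.const_mul _)
  simp_rw [e]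
  rw [integral_add i3 (integrable_const _), integral_sub i2 (i1.const_mul _), integral_const_mul]
  simp
  ring

theorem sq_integral_le (hu : MemLp u 2 μ) :
    (∫ x, u x ∂μ) ^ 2 ≤ μ.real univ * ∫ x, u x ^ 2 ∂μ := by
  set m := μ.real univ with hm
  set I := ∫ x, u x ∂μ with hI
  rcases (measureReal_nonneg : 0 ≤ m).eq_or_lt with h0 | h0
  · have : μ = 0 := by
      rw [← Measure.measure_univ_eq_zero]
      exact (measureReal_eq_zero_iff).1 h0.symm
    simp [hI, this]
  · have h := integral_sub_const_sq hu (I / m)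
    have h1 : 0 ≤ ∫ x, (u x - I / m) ^ 2 ∂μ := integral_nonneg fun x => sq_nonneg _
    rw [h, ← hm, ← hI] at h1
    have h2 : (∫ x, u x ^ 2 ∂μ) - 2 * (I / m) * I + (I / m) ^ 2 * m
      = (∫ x, u x ^ 2 ∂μ) - I ^ 2 / m := by
      field_simp
      ring
    rw [h2, sub_nonneg, div_le_iff₀ h0] at h1
    linarith

end finite

/-- Passing from the mean over `K` to the mean over a part `B` of it, at the expense of a factor
`3 |K| / |B|`: if `T` bounds the variance over `K`, then the two means differ by at most
`(T / |B|)^{1/2}`. -/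
theorem integral_sq_le_of_average {X : Type*} [MeasurableSpace X] {μ : Measure X} {B K : Set X}
    {u : X → ℝ} {T : ℝ} (hBK : B ⊆ K) (hK : μ K ≠ ⊤) (hB0 : 0 < μ.real B)
    (hu : MemLp u 2 (μ.restrict K))
    (hT : μ.real K * (∫ x in K, u x ^ 2 ∂μ) - (∫ x in K, u x ∂μ) ^ 2 ≤ μ.real K * T) :
    ∫ x in K, u x ^ 2 ∂μ ≤ 3 * (μ.real K / μ.real B) * (μ.real B * (⨍ x in B, u x ∂μ) ^ 2 + T) := by
  have : IsFiniteMeasure (μ.restrict K) := ⟨by simpa using hK.lt_top⟩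
  have : IsFiniteMeasure (μ.restrict B) :=
    ⟨by simpa using (measure_mono hBK).trans_lt hK.lt_top⟩
  have huB : MemLp u 2 (μ.restrict B) := hu.mono_measure (Measure.restrict_mono hBK le_rfl)
  have hle : μ.real B ≤ μ.real K := measureReal_mono hBK hK
  set β := μ.real B with hβ
  set κ := μ.real K with hκ
  have hκ0 : 0 < κ := hB0.trans_le hle
  set I := ∫ x in K, u x ∂μ with hI
  set J := ∫ x in B, u x ∂μ with hJ
  set S := ∫ x in K, u x ^ 2 ∂μ with hS
  have havg : ⨍ x in B, u x ∂μ = J / β := by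
    rw [setAverage_eq, smul_eq_mul, ← hβ, ← hJ]
    field_simp
  set c := I / κ with hc
  have h1 := integral_sub_const_sq hu c
  rw [measureReal_restrict_apply_univ, ← hκ, ← hI, ← hS] at h1
  have h1' : S - 2 * c * I + c ^ 2 * κ = S - κ * c ^ 2 := by
    simp only [hc]
    field_simp
    ring
  rw [h1'] at h1
  have hVT : S - κ * c ^ 2 ≤ T := by
    have : κ * (S - κ * c ^ 2) ≤ κ * T := by
      have e : κ * (S - κ * c ^ 2) = κ * S - I ^ 2 := by
        simp only [hc]
        field_simp
      rwa [e]
    exact le_of_mul_le_mul_left this hκ0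
  have h2 : (∫ x in B, (u x - c) ∂μ) ^ 2 ≤ β * ∫ x in B, (u x - c) ^ 2 ∂μ := by
    have := sq_integral_le (huB.sub (memLp_const c))
    rwa [measureReal_restrict_apply_univ] at this
  have h3 : ∫ x in B, (u x - c) ∂μ = J - β * c := by
    rw [integral_sub (huB.integrable (by norm_num)) (integrable_const _)]
    simp [hJ, hβ]
  have h4 : ∫ x in B, (u x - c) ^ 2 ∂μ ≤ ∫ x in K, (u x - c) ^ 2 ∂μ :=
    setIntegral_mono_set (hu.sub (memLp_const c)).integrable_sq
      (Filter.Eventually.of_forall fun x => sq_nonneg _) hBK.eventuallyLE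
  rw [h1] at h4
  rw [h3] at h2
  have h5 : β * (J / β - c) ^ 2 ≤ T := by
    have e : β * (J / β - c) ^ 2 = (J - β * c) ^ 2 / β := by field_simp
    rw [e, div_le_iff₀ hB0]
    nlinarith
  rw [havg]
  set q := J / β with hq
  have hT0 : 0 ≤ T := le_trans (by positivity) h5
  have h6 : 3 * (κ / β) * (β * q ^ 2 + T) = 3 * κ * q ^ 2 + 3 * (κ / β) * T := by
    field_simp
  have h7 : 1 ≤ κ / β := (one_le_div hB0).2 hle
  have h8 : κ * (q - c) ^ 2 ≤ κ / β * T := by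
    rw [div_mul_eq_mul_div, le_div_iff₀ hB0]
    nlinarith
  rw [h6]
  nlinarith [sq_nonneg (q - c), sq_nonneg q, sq_nonneg (2 * q - c),
    mul_nonneg hκ0.le (sq_nonneg (2 * q - c))]

namespace LocalData

variable {d m : ℕ} {Ω : Set (Space d)} (D : LocalData Ω m)

theorem isBounded_K (hΩ : Bornology.IsBounded Ω) (i : Fin m) : Bornology.IsBounded (D.K i) := by
  have hne : (interior (D.K i)).Nonempty :=
    (D.B_nonempty i).mono (interior_maximal (D.B_subset_K i) (D.B_open i))
  refine (hΩ.subset (D.K_interior i)).closure.subset ?_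
  rw [(D.K_convex i).closure_interior_eq_closure_of_nonempty_interior hne]
  exact subset_closure

theorem B_subset_interior (i : Fin m) : D.B i ⊆ interior (D.K i) :=
  interior_maximal (D.B_subset_K i) (D.B_open i)

/-- The boundary of a convex set is a null set. -/
theorem volume_interior (i : Fin m) : volume (interior (D.K i)) = volume (D.K i) := by
  refine measure_congr ?_
  have h := (D.K_convex i).addHaar_frontier volume
  refine ae_eq_set.2 ⟨by rw [sdiff_eq_empty.2 interior_subset, measure_empty],
    measure_mono_null (fun x hx => ?_) h⟩
  exact ⟨subset_closure hx.1, hx.2⟩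

theorem volume_B_pos (hΩ : Bornology.IsBounded Ω) (i : Fin m) : 0 < volume.real (D.B i) :=
  ENNReal.toReal_pos ((D.B_open i).measure_pos volume (D.B_nonempty i)).ne'
    (hΩ.subset (D.B_subset i)).measure_lt_top.ne

theorem diam_le_R (i : Fin m) : Metric.diam (D.K i) ≤ D.R :=
  le_ciSup (f := fun i => Metric.diam (D.K i)) (finite_range _).bddAbove i

theorem R_nonneg : 0 ≤ D.R := Real.iSup_nonneg fun _ => Metric.diam_nonneg

theorem η_nonneg : 0 ≤ D.η := by
  unfold η
  split_ifs
  · exact zero_le_one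
  · exact mul_nonneg (by norm_num) (Real.iSup_nonneg fun i =>
      div_nonneg measureReal_nonneg measureReal_nonneg)

theorem κ_nonneg (P : EllipticData Ω) : 0 ≤ D.κ P := by
  have := P.αmin_pos
  unfold κ
  positivity

theorem ncard_le_M {x : Space d} (hx : x ∈ Ω) : {i | x ∈ D.K i}.ncard ≤ D.M := by
  refine le_ciSup (f := fun x : Ω => {i | (x : Space d) ∈ D.K i}.ncard) ?_ ⟨x, hx⟩
  refine ⟨m, ?_⟩
  rintro _ ⟨y, rfl⟩
  simpa using Set.ncard_le_card (s := {i | (y : Space d) ∈ D.K i})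

/-- The local estimate on `K i`, with the mean of `v` taken over `B i`. -/
theorem setIntegral_interior_sq_le (hΩo : IsOpen Ω) (hΩ : Bornology.IsBounded Ω) (v : H1 Ω)
    (i : Fin m) :
    ∫ x in interior (D.K i), fn v x ^ 2
      ≤ D.η * (volume.real (D.B i) * D.avg v i ^ 2
        + (D.R / Real.pi) ^ 2 * ∫ x in interior (D.K i), ‖grad v x‖ ^ 2) := by
  have hKb := D.isBounded_K hΩ i
  have hKv : volume (interior (D.K i)) ≠ ⊤ := (hKb.subset interior_subset).measure_lt_top.ne
  have hu := memLp_restrict (D.K_interior i) (fn v)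
  have hY0 : 0 ≤ ∫ x in interior (D.K i), ‖grad v x‖ ^ 2 := integral_nonneg fun x => sq_nonneg _
  have hp := le_div_pi_sq_mul_of_forall (D := D.R) D.R_nonneg
    (mul_nonneg measureReal_nonneg hY0) fun k hk hkD =>
      IsWeakGradient.variance_le (w := fn v) (G := grad v) v.2 hΩo.measurableSet (D.K_interior i)
        isOpen_interior (D.K_convex i).interior hKv
        (fun x hx y hy => (Metric.dist_le_diam_of_mem hKb (interior_subset hx)
          (interior_subset hy)).trans (D.diam_le_R i)) hk hkD
  rw [mul_left_comm] at hp
  set T := (D.R / Real.pi) ^ 2 * ∫ x in interior (D.K i), ‖grad v x‖ ^ 2 with hT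
  have hT0 : 0 ≤ T := mul_nonneg (sq_nonneg _) hY0
  have hB0 := D.volume_B_pos hΩ i
  have hrhs : 0 ≤ volume.real (D.B i) * D.avg v i ^ 2 + T := by positivity
  unfold η
  split_ifs with hBK
  · have hint : interior (D.K i) = D.B i := by
      rw [← hBK i, (D.B_open i).interior_eq]
    rw [hint] at hp ⊢
    have havg : D.avg v i = (∫ x in D.B i, fn v x) / volume.real (D.B i) := by
      rw [avg, setAverage_eq, smul_eq_mul, inv_mul_eq_div]
    rw [one_mul, havg]
    refine le_of_mul_le_mul_left ?_ hB0
    have e : volume.real (D.B i) * (volume.real (D.B i)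
        * ((∫ x in D.B i, fn v x) / volume.real (D.B i)) ^ 2 + T)
        = (∫ x in D.B i, fn v x) ^ 2 + volume.real (D.B i) * T := by
      field_simp
    rw [e]
    linarith
  · have h := integral_sq_le_of_average (D.B_subset_interior i) hKv hB0
      hu hp
    refine h.trans (mul_le_mul_of_nonneg_right ?_ hrhs)
    refine mul_le_mul_of_nonneg_left ?_ (by norm_num)
    rw [measureReal_def (s := interior _), D.volume_interior i, ← measureReal_def]
    exact le_ciSup (f := fun i => volume.real (D.K i) / volume.real (D.B i))
      (finite_range _).bddAbove i

theorem setIntegral_eq_sum_interior_le (hΩo : IsOpen Ω) {g : Space d → ℝ} (hg : ∀ x, 0 ≤ g x)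
    (hgi : IntegrableOn g Ω) :
    ∫ x in Ω, g x ≤ ∑ i, ∫ x in interior (D.K i), g x := by
  have h1 : ∀ i, ∫ x in interior (D.K i), g x = ∫ x in Ω, (interior (D.K i)).indicator g x := by
    intro i
    rw [setIntegral_indicator isOpen_interior.measurableSet, inter_eq_right.2 (D.K_interior i)]
  simp_rw [h1]
  rw [← integral_finsetSum _ fun i _ => hgi.indicator isOpen_interior.measurableSet]
  refine integral_mono_ae hgi (integrable_finsetSum _ fun i _ =>
    hgi.indicator isOpen_interior.measurableSet) ?_
  have h2 : ∀ᵐ x ∂(volume.restrict Ω), ∀ i, x ∉ frontier (D.K i) := by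
    rw [ae_all_iff]
    exact fun i => ae_restrict_of_ae (measure_eq_zero_iff_ae_notMem.1
      ((D.K_convex i).addHaar_frontier volume))
  filter_upwards [h2, ae_restrict_mem hΩo.measurableSet] with x hx hxΩ
  obtain ⟨i, hi⟩ := mem_iUnion.1 (D.K_cover hxΩ)
  have hxi : x ∈ interior (D.K i) := by
    by_contra h
    exact hx i ⟨hi, h⟩
  refine le_trans ?_ (Finset.single_le_sum (f := fun i => (interior (D.K i)).indicator g x)
    (fun j _ => indicator_nonneg (fun y _ => hg y) x) (Finset.mem_univ i))
  rw [indicator_of_mem hxi]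

theorem sum_setIntegral_interior_le (hΩo : IsOpen Ω) {g : Space d → ℝ} (hg : ∀ x, 0 ≤ g x)
    (hgi : IntegrableOn g Ω) :
    ∑ i, ∫ x in interior (D.K i), g x ≤ D.M * ∫ x in Ω, g x := by
  have h1 : ∀ i, ∫ x in interior (D.K i), g x = ∫ x in Ω, (interior (D.K i)).indicator g x := by
    intro i
    rw [setIntegral_indicator isOpen_interior.measurableSet, inter_eq_right.2 (D.K_interior i)]
  simp_rw [h1]
  rw [← integral_finsetSum _ fun i _ => hgi.indicator isOpen_interior.measurableSet,
    ← integral_const_mul]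
  refine setIntegral_mono_on (integrable_finsetSum _ fun i _ =>
    hgi.indicator isOpen_interior.measurableSet) (hgi.const_mul _) hΩo.measurableSet fun x hx => ?_
  classical
  have h2 : ∑ i, (interior (D.K i)).indicator g x
      = (Finset.univ.filter fun i => x ∈ interior (D.K i)).card * g x := by
    simp only [indicator_apply]
    rw [← Finset.sum_filter, Finset.sum_const, nsmul_eq_mul]
  rw [h2]
  refine mul_le_mul_of_nonneg_right ?_ (hg x)
  have h3 := D.ncard_le_M hx
  rw [Set.ncard_eq_toFinset_card'] at h3
  refine Nat.cast_le.2 (le_trans (Finset.card_le_card fun i hi => ?_) h3)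
  simp only [Finset.mem_filter, Finset.mem_univ, true_and] at hi
  simpa using interior_subset hi

end LocalData

/-! ### The bilinear forms -/

section forms

variable {d m : ℕ} {Ω : Set (Space d)}

theorem fn_sub (w v : H1 Ω) : fn (w - v) = fn w - fn v := rfl

theorem grad_sub (w v : H1 Ω) : grad (w - v) = grad w - grad v := rfl

theorem integral_mul_eq_inner (g h : L2 Ω) : ∫ x in Ω, g x * h x = inner ℝ g h := by
  rw [L2.inner_def]
  congr 1
  ext x
  simp [mul_comm]

theorem norm_sq_eq_integral (g : L2 Ω) : ‖g‖ ^ 2 = ∫ x in Ω, g x ^ 2 := by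
  rw [← real_inner_self_eq_norm_sq, ← integral_mul_eq_inner]
  congr 1
  ext x
  ring

theorem integrable_norm_grad_sq (v : H1 Ω) : IntegrableOn (fun x => ‖grad v x‖ ^ 2) Ω :=
  (memLp_norm_restrict Subset.rfl (grad v)).integrable_sq

namespace EllipticData

variable (P : EllipticData Ω)

theorem integrable_α_mul (w v : H1 Ω) :
    IntegrableOn (fun x => P.α x * inner ℝ (grad w x) (grad v x)) Ω := by
  have h : Integrable (fun x => inner ℝ (grad w x) (grad v x)) (volume.restrict Ω) :=
    L2.integrable_inner (𝕜 := ℝ) (grad w) (grad v)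
  refine h.bdd_mul (c := P.αmax) P.α_meas ?_
  filter_upwards [P.α_bounds] with x hx
  rw [Real.norm_of_nonneg (P.αmin_pos.le.trans hx.1)]
  exact hx.2

theorem integrable_σ_mul (w v : H1 Ω) :
    IntegrableOn (fun x => P.σ x * fn w x * fn v x) Ω := by
  have h : Integrable (fun x => fn w x * fn v x) (volume.restrict Ω) :=
    (Lp.memLp (fn w)).integrable_mul (Lp.memLp (fn v))
  simp_rw [mul_assoc]
  refine h.bdd_mul (c := P.σmax) P.σ_meas ?_
  filter_upwards [P.σ_bounds] with x hx
  rw [Real.norm_of_nonneg hx.1]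
  exact hx.2

theorem integrable_a (w v : H1 Ω) :
    IntegrableOn (fun x => P.α x * inner ℝ (grad w x) (grad v x) + P.σ x * fn w x * fn v x) Ω :=
  (P.integrable_α_mul w v).add (P.integrable_σ_mul w v)

theorem a_sub_left (w u v : H1 Ω) : P.a (w - u) v = P.a w v - P.a u v := by
  unfold a
  rw [← integral_sub (P.integrable_a w v) (P.integrable_a u v)]
  refine integral_congr_ae ?_
  rw [fn_sub, grad_sub]
  filter_upwards [Lp.coeFn_sub (fn w) (fn u), Lp.coeFn_sub (grad w) (grad u)] with x h1 h2
  rw [h1, h2, Pi.sub_apply, Pi.sub_apply, inner_sub_left]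
  ring

theorem αmin_mul_le_a (v : H1 Ω) : P.αmin * ∫ x in Ω, ‖grad v x‖ ^ 2 ≤ P.a v v := by
  unfold a
  rw [← integral_const_mul]
  refine integral_mono_ae ((integrable_norm_grad_sq v).const_mul _)
    (P.integrable_a v v) ?_
  filter_upwards [P.α_bounds, P.σ_bounds] with x h1 h2
  rw [real_inner_self_eq_norm_sq, mul_assoc (P.σ x)]
  nlinarith [mul_le_mul_of_nonneg_right h1.1 (sq_nonneg ‖grad v x‖),
    mul_nonneg h2.1 (mul_self_nonneg (fn v x))]

end EllipticData

namespace LocalData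

variable (D : LocalData Ω m)

theorem volume_mul_avg (hΩ : Bornology.IsBounded Ω) (v : H1 Ω) (i : Fin m) :
    volume.real (D.B i) * D.avg v i = ∫ x in D.B i, fn v x := by
  have := D.volume_B_pos hΩ i
  rw [avg, setAverage_eq, smul_eq_mul]
  field_simp

theorem avg_sub (hΩ : Bornology.IsBounded Ω) (w u : H1 Ω) (i : Fin m) :
    D.avg (w - u) i = D.avg w i - D.avg u i := by
  have h0 := D.volume_B_pos hΩ i
  refine mul_left_cancel₀ h0.ne' ?_
  have : IsFiniteMeasure (volume.restrict (D.B i)) :=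
    ⟨by simpa using (hΩ.subset (D.B_subset i)).measure_lt_top⟩
  have hi : ∀ v : H1 Ω, Integrable (fn v) (volume.restrict (D.B i)) := fun v =>
    (memLp_restrict (D.B_subset i) (fn v)).integrable (by norm_num)
  rw [mul_sub, D.volume_mul_avg hΩ, D.volume_mul_avg hΩ, D.volume_mul_avg hΩ,
    ← integral_sub (hi w) (hi u)]
  refine integral_congr_ae ?_
  rw [fn_sub]
  exact ae_mono (Measure.restrict_mono (D.B_subset i) le_rfl) (Lp.coeFn_sub (fn w) (fn u))

theorem b_sub_left (hΩ : Bornology.IsBounded Ω) (w u v : H1 Ω) :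
    D.b (w - u) v = D.b w v - D.b u v := by
  unfold b
  rw [← Finset.sum_sub_distrib]
  refine Finset.sum_congr rfl fun i _ => ?_
  rw [D.avg_sub hΩ]
  ring

theorem b_self (v : H1 Ω) : D.b v v = ∑ i, volume.real (D.B i) * D.avg v i ^ 2 :=
  Finset.sum_congr rfl fun i _ => by ring

theorem b_self_nonneg (v : H1 Ω) : 0 ≤ D.b v v := by
  rw [b_self]
  exact Finset.sum_nonneg fun i _ => mul_nonneg measureReal_nonneg (sq_nonneg _)

/-- The stability estimate `‖v‖² ≤ Γ c(v,v)`: the local Poincaré inequalities summed over `i`. -/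
theorem norm_sq_le_Γ_mul_c (hΩo : IsOpen Ω) (hΩ : Bornology.IsBounded Ω) (P : EllipticData Ω)
    {δ : ℝ} (hδ : 0 < δ) (v : H1 Ω) : ‖fn v‖ ^ 2 ≤ D.Γ P δ * D.c P δ v v := by
  have hη := D.η_nonneg
  have hg := D.sum_setIntegral_interior_le hΩo (g := fun x => ‖grad v x‖ ^ 2)
    (fun x => sq_nonneg _) (integrable_norm_grad_sq v)
  have h1 : ‖fn v‖ ^ 2 ≤ D.η * (D.b v v
      + (D.R / Real.pi) ^ 2 * (D.M * ∫ x in Ω, ‖grad v x‖ ^ 2)) := by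
    rw [norm_sq_eq_integral]
    refine (D.setIntegral_eq_sum_interior_le hΩo (fun x => sq_nonneg _)
      (Lp.memLp (fn v)).integrable_sq).trans ?_
    refine (Finset.sum_le_sum fun i _ => D.setIntegral_interior_sq_le hΩo hΩ v i).trans ?_
    rw [← Finset.mul_sum, Finset.sum_add_distrib, ← Finset.mul_sum, b_self]
    gcongr
  have hpi := Real.pi_pos
  have hα := P.αmin_pos
  have h2 : (D.R / Real.pi) ^ 2 * (D.M * ∫ x in Ω, ‖grad v x‖ ^ 2) ≤ D.κ P * P.a v v := by
    have e : (D.R / Real.pi) ^ 2 * (D.M * ∫ x in Ω, ‖grad v x‖ ^ 2)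
        = D.κ P * (P.αmin * ∫ x in Ω, ‖grad v x‖ ^ 2) := by
      unfold κ
      field_simp
    rw [e]
    exact mul_le_mul_of_nonneg_left (P.αmin_mul_le_a v) (D.κ_nonneg P)
  have ha : 0 ≤ P.a v v := le_trans
    (mul_nonneg hα.le (integral_nonneg fun x => sq_nonneg _)) (P.αmin_mul_le_a v)
  have hb := D.b_self_nonneg v
  have h3 : D.b v v + D.κ P * P.a v v ≤ max (D.κ P) δ * (P.a v v + δ⁻¹ * D.b v v) := by
    have e1 : D.κ P * P.a v v ≤ max (D.κ P) δ * P.a v v :=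
      mul_le_mul_of_nonneg_right (le_max_left _ _) ha
    have e2 : δ * (δ⁻¹ * D.b v v) ≤ max (D.κ P) δ * (δ⁻¹ * D.b v v) :=
      mul_le_mul_of_nonneg_right (le_max_right _ _) (by positivity)
    rw [mul_inv_cancel_left₀ hδ.ne'] at e2
    linarith
  unfold Γ c
  rw [mul_assoc]
  exact h1.trans (mul_le_mul_of_nonneg_left (by linarith) hη)

end LocalData

/-! ### Functionals represented by square integrable functions -/

theorem l2FunctionalNorm_nonneg (V : Submodule ℝ (H1 Ω)) (F : H1 Ω → ℝ) :
    0 ≤ l2FunctionalNorm V F :=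
  Real.sInf_nonneg (by rintro _ ⟨g, _, rfl⟩; exact norm_nonneg g)

/-- The Cauchy–Schwarz inequality for a functional in `L²(Ω)`. It holds for every representing function,
so that their uniqueness is not needed. -/
theorem IsL2Functional.le_norm_mul {V : Submodule ℝ (H1 Ω)} {F : H1 Ω → ℝ}
    (hF : IsL2Functional V F) {v : H1 Ω} (hv : v ∈ V) :
    F v ≤ l2FunctionalNorm V F * ‖fn v‖ := by
  have h : ∀ g ∈ representers V F, F v ≤ ‖g‖ * ‖fn v‖ := fun g hg => by
    rw [hg v hv, integral_mul_eq_inner]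
    exact real_inner_le_norm g (fn v)
  rcases (norm_nonneg (fn v)).eq_or_lt with h0 | h0
  · obtain ⟨g, hg⟩ := hF
    have := h g hg
    rw [← h0, mul_zero] at this ⊢
    exact this
  · rw [← div_le_iff₀ h0]
    refine le_csInf (hF.image _) ?_
    rintro _ ⟨g, hg, rfl⟩
    exact (div_le_iff₀ h0).2 (h g hg)

/-- The data mismatch is represented by the step function `∑ᵢ (bᵢ - ⟨u⟩ᵢ) 1_{Bᵢ}`. -/
theorem LocalData.isL2Functional_bInexact_sub (D : LocalData Ω m) (hΩ : Bornology.IsBounded Ω)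
    (V : Submodule ℝ (H1 Ω)) (u : H1 Ω) :
    IsL2Functional V (fun v => D.bInexact v - D.b u v) := by
  have hfin : ∀ i, (volume.restrict Ω) (D.B i) ≠ ⊤ := fun i =>
    ((Measure.restrict_apply_le _ _).trans_lt (hΩ.subset (D.B_subset i)).measure_lt_top).ne
  refine ⟨∑ i, indicatorConstLp 2 (D.B_open i).measurableSet (hfin i) (D.val i - D.avg u i),
    fun v _ => ?_⟩
  rw [integral_mul_eq_inner, sum_inner]
  change D.bInexact v - D.b u v = _
  unfold bInexact b
  rw [← Finset.sum_sub_distrib]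
  refine Finset.sum_congr rfl fun i _ => ?_
  rw [L2.inner_indicatorConstLp_eq_inner_setIntegral,
    Measure.restrict_restrict_of_subset (D.B_subset i), ← D.volume_mul_avg hΩ]
  simp
  ring

end forms

end PDEReg

/-! ### The error estimate -/

open PDEReg in
theorem mainTheorem1 {d m : ℕ} (Ω : Set (PDEReg.Space d))
    (hΩ_open : IsOpen Ω) (hΩ_bdd : Bornology.IsBounded Ω)
    (V : Submodule ℝ (PDEReg.H1 Ω))
    (hV_closed : IsClosed (V : Set (PDEReg.H1 Ω)))
    (hV_H10 : PDEReg.H10 Ω ⊆ (V : Set (PDEReg.H1 Ω)))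
    (P P' : PDEReg.EllipticData Ω) (D : PDEReg.LocalData Ω m)
    (δ : ℝ) (hδ : 0 < δ)
    (u : PDEReg.H1 Ω) (hu : u ∈ V) (hu_eq : ∀ v ∈ V, P.a u v = P.l v)
    (u' : PDEReg.H1 Ω) (hu' : u' ∈ V) (hu'_eq : ∀ v ∈ V, D.c P' δ u' v = D.r P' δ v)
    (hres : PDEReg.IsL2Functional V (fun v => P'.l v - P'.a u v)) :
    (‖PDEReg.fn (u' - u)‖ ≤ √(D.Γ P' δ) * D.cNorm P' δ (u' - u) ∧
      √(D.Γ P' δ) * D.cNorm P' δ (u' - u)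
        ≤ D.Γ P' δ * (PDEReg.Epde V P' u + δ⁻¹ * PDEReg.Edata V D u)) ∧
    ∀ θ : ℝ, 0 < θ → θ ≤ 1 → δ ∈ Set.Icc (θ * D.κ P') (θ⁻¹ * D.κ P') →
      ‖PDEReg.fn (u' - u)‖ ≤ √(D.Γ P' δ) * D.cNorm P' δ (u' - u) ∧
      √(D.Γ P' δ) * D.cNorm P' δ (u' - u)
        ≤ D.η * θ⁻¹ * (D.κ P' * PDEReg.Epde V P' u + PDEReg.Edata V D u) := by
  set e := u' - u with he
  have heV : e ∈ V := V.sub_mem hu' hu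
  have hη := D.η_nonneg
  have hκ := D.κ_nonneg P'
  have hstab := D.norm_sq_le_Γ_mul_c hΩ_open hΩ_bdd P' hδ e
  have hΓ : 0 ≤ D.Γ P' δ := mul_nonneg hη (hκ.trans (le_max_left _ _))
  have hE1 : 0 ≤ Epde V P' u := l2FunctionalNorm_nonneg _ _
  have hE2 : 0 ≤ Edata V D u := l2FunctionalNorm_nonneg _ _
  have hc0 : 0 ≤ D.c P' δ e e := by
    have h1 := P'.αmin_mul_le_a e
    have h2 : 0 ≤ P'.αmin * ∫ x in Ω, ‖grad e x‖ ^ 2 :=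
      mul_nonneg P'.αmin_pos.le (integral_nonneg fun x => sq_nonneg _)
    have h3 := D.b_self_nonneg e
    have h4 : 0 ≤ δ⁻¹ * D.b e e := by positivity
    unfold LocalData.c
    linarith
  have hfirst : ‖fn e‖ ≤ √(D.Γ P' δ) * D.cNorm P' δ e := by
    rw [LocalData.cNorm, ← Real.sqrt_mul hΓ]
    exact Real.le_sqrt_of_sq_le hstab
  -- testing the equation of `u'` with the error `e` leaves the residuals of `u`
  have hcee : D.c P' δ e e = (P'.l e - P'.a u e) + δ⁻¹ * (D.bInexact e - D.b u e) := by
    have h1 := hu'_eq e heV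
    have h2 : D.c P' δ e e = D.c P' δ u' e - D.c P' δ u e := by
      unfold LocalData.c
      rw [he, P'.a_sub_left, D.b_sub_left hΩ_bdd]
      ring
    rw [h2, h1]
    unfold LocalData.r LocalData.c
    ring
  have hcle : D.c P' δ e e ≤ (Epde V P' u + δ⁻¹ * Edata V D u) * ‖fn e‖ := by
    have h1 : P'.l e - P'.a u e ≤ Epde V P' u * ‖fn e‖ := hres.le_norm_mul heV
    have h2 : D.bInexact e - D.b u e ≤ Edata V D u * ‖fn e‖ :=
      (D.isL2Functional_bInexact_sub hΩ_bdd V u).le_norm_mul heV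
    have h3 := mul_le_mul_of_nonneg_left h2 (inv_pos.2 hδ).le
    rw [hcee]
    linarith
  set N := D.cNorm P' δ e with hN
  have hN0 : 0 ≤ N := Real.sqrt_nonneg _
  have hN2 : N ^ 2 = D.c P' δ e e := Real.sq_sqrt hc0
  set s := √(D.Γ P' δ) with hs
  have hs0 : 0 ≤ s := Real.sqrt_nonneg _
  have hs2 : s ^ 2 = D.Γ P' δ := Real.sq_sqrt hΓ
  set E := Epde V P' u + δ⁻¹ * Edata V D u with hE
  have hE0 : 0 ≤ E := by positivity
  have hNE : N ≤ E * s := by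
    rcases hN0.eq_or_lt with h | h
    · rw [← h]
      positivity
    · refine le_of_mul_le_mul_right ?_ h
      calc N * N = N ^ 2 := by ring
        _ ≤ E * ‖fn e‖ := by rw [hN2]; exact hcle
        _ ≤ E * (s * N) := mul_le_mul_of_nonneg_left hfirst hE0
        _ = E * s * N := by ring
  have hsecond : s * N ≤ D.Γ P' δ * E := by
    rw [← hs2]
    nlinarith [mul_le_mul_of_nonneg_left hNE hs0]
  refine ⟨⟨hfirst, hsecond⟩, fun θ hθ hθ1 hδθ => ⟨hfirst, hsecond.trans ?_⟩⟩
  have hθ' : 1 ≤ θ⁻¹ := (one_le_inv₀ hθ).2 hθ1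
  have hm1 : max (D.κ P') δ ≤ θ⁻¹ * D.κ P' := max_le (le_mul_of_one_le_left hκ hθ') hδθ.2
  have hm2 : max (D.κ P') δ * δ⁻¹ ≤ θ⁻¹ := by
    rw [← div_eq_mul_inv, div_le_iff₀ hδ]
    refine max_le ?_ (le_mul_of_one_le_left hδ.le hθ')
    rw [inv_mul_eq_div, le_div_iff₀ hθ, mul_comm]
    exact hδθ.1
  calc D.Γ P' δ * E = D.η * (max (D.κ P') δ * Epde V P' u
        + max (D.κ P') δ * δ⁻¹ * Edata V D u) := by
        rw [hE, LocalData.Γ]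
        ring
    _ ≤ D.η * (θ⁻¹ * D.κ P' * Epde V P' u + θ⁻¹ * Edata V D u) := by gcongr
    _ = _ := by ring
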